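/- Let $d\ge 1$, let $\Omega\subset\mathbb R^d$ be measurable and let $\sigma:\Omega\to\mathbb R$ be measurable. Put $a_\sigma(e)=\mathrm{meas}\{x\in\Omega:\sigma(x)<e\}$ for $e\in\mathbb R$, assume that $\{e\in\mathbb R: a_\sigma(e)<\mathrm{meas}(\Omega)\}\neq\varnothing$, and put $e_{\max}=\sup\{e\in\mathbb R: a_\sigma(e)<\mathrm{meas}(\Omega)\}\in(-\infty,+\infty]$ and $e_{\min}=\operatorname{ess\,inf}_\Omega\sigma$. Assume $e_{\min}<e_{\max}$, $\mathrm{meas}\{x\in\Omega:\sigma(x)=e\}=0$ for every real $e<e_{\max}$, and $a_\sigma(e)\to\mathrm{meas}(\Omega)$ as $e\to e_{\max}$, $e<e_{\max}$. Put $b_\sigma(\mu)=\sup\{t<e_{\max}: a_\sigma(t)\le\mu\}$ for $\mu\ge0$, with $\sup\varnothing=-\infty$. For a nonnegative $q\in L^1(\Omega)$ let $\mu_q(t)=\mathrm{meas}\{x\in\Omega:q(x)>t\}$, $q^\sharp(s)=\inf\{t\ge0:\mu_q(t)\le s\}$, $q^*(x)=q^\sharp(\mathrm{meas}(B(0,|x|)\cap\Omega))$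 and $q^{*\sigma}(x)=q^\sharp(a_\sigma(\sigma(x)))\mathbf 1_{\sigma(x)<e_{\max}}$. For nonnegative $f,g\in L^1(\Omega)$ let $\beta_{f,g}(s)=\mathrm{meas}\{x\in\Omega: f(x)\le s<g(x)\}$. Assume that $B_\sigma(\mu)=\int_{\{a_\sigma(\sigma(x))<\mu\}}\sigma(x)\,dx$ is well defined and finite for every $\mu\in[0,\mathrm{meas}(\Omega))$. If $\mathrm{meas}(\Omega)<\infty$, continue $B_\sigma$ to $\mu\ge\mathrm{meas}(\Omega)$ by $B_\sigma(\mu)=\int_\Omega\sigma\,dx+e_{\max}\,(\mu-\mathrm{meas}(\Omega))\in(-\infty,+\infty]$, that is, with slope $b_\sigma(\mu)=e_{\max}$. For $0<\mu<\infty$ let $$H_\sigma(\mu)=\inf_{0<s\le\mu}\frac{B_\sigma(\mu+s)+B_\sigma(\mu-s)-2B_\sigma(\mu)}{s^2},\qquad K(q^*,\sigma)=4\int_0^{\|q\|_{L^\infty}}\frac{dt}{H_\sigma(\mu_q(t))}\in[0,+\infty],$$ where $0\cdot(\pm\infty)=0$, $1/0=+\infty$, $1/(+\infty)=0$, and $1/H_\sigma(\mu)=+\infty$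 if $B_\sigma(\mu)=+\infty$. For nonnegative $f,q\in L^1(\Omega)$ write $$I=\int_\Omega\sigma\,(f-q^{*\sigma})\,dx,\qquad C=\int_0^\infty\big[\beta_{f^*,q^*}(s)\,b_\sigma(2\mu_q(s))-\beta_{q^*,f^*}(s)\,b_\sigma(\mu_q(s))\big]ds,$$ and suppose that the positive parts of the two integrands have finite integrals, so that $I,C\in[-\infty,+\infty)$ (otherwise the right-hand sides below are $+\infty$ or undefined). Then: (i) $B_\sigma$ is convex on $[0,\mathrm{meas}(\Omega))$. (ii) For every nonzero nonnegative $q\in L^1(\Omega)$ with $K(q^*,\sigma)<\infty$ and every such $f$, $$\big(\|f-q^{*\sigma}\|_{L^1(\Omega)}+\|q\|_{L^1(\Omega)}-\|f\|_{L^1(\Omega)}\big)^2\le K(q^*,\sigma)\,[\,I+C\,].$$ In particular, for every nonnegative $f\in L^1(\Omega)$ with $K(f^*,\sigma)<\infty$ for which the positive part of $\sigma(f-f^{*\sigma})$ is integrable, $$\|f-f^{*\sigma}\|_{L^1(\Omega)}^2\le K(f^*,\sigma)\int_\Omega\sigma\,(f-f^{*\sigma})\,dx .$$ (iii) For all such $f,q$,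 whether or not $K(q^*,\sigma)$ is finite, with $\beta=\beta_{f,q^{*\sigma}}$, $$I\ \ge\ \int_0^\infty\big[B_\sigma(\mu_q(s)+\beta(s))+B_\sigma(\mu_q(s)-\beta(s))-2B_\sigma(\mu_q(s))\big]ds\;-\;C,$$ provided $B_\sigma(\mu_q(s))$ is finite for almost every $s>0$ (automatic if $\mathrm{meas}(\Omega)=\infty$). -/

import Mathlib

open MeasureTheory Set Filter Topology
open scoped ENNReal NNReal

namespace RefinedHL

noncomputable section

/-- The Lebesgue integral with values in the extended reals: integral of the positive part minus
integral of the negative part. It is the usual one as soon as one of the two is finite. -/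
def extIntegral {α : Type*} [MeasurableSpace α] (ν : Measure α) (g : α → EReal) : EReal :=
  ((∫⁻ x, (g x).toENNReal ∂ν : ℝ≥0∞) : EReal) - ((∫⁻ x, (-g x).toENNReal ∂ν : ℝ≥0∞) : EReal)

/-- The positive part of `g` has a finite integral, i.e. the integral of `g` makes sense in
`[-∞, +∞)`. -/
def PosPartIntegrable {α : Type*} [MeasurableSpace α] (ν : Measure α) (g : α → EReal) : Prop :=
  ∫⁻ x, (g x).toENNReal ∂ν ≠ ⊤

variable {d : ℕ}

/-- The distribution function `μ_q(t) = meas {x ∈ Ω : q(x) > t}`. -/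
def distrib (Ω : Set (EuclideanSpace ℝ (Fin d))) (q : EuclideanSpace ℝ (Fin d) → ℝ) (t : ℝ) :
    ℝ≥0∞ :=
  volume {x | x ∈ Ω ∧ t < q x}

/-- The pseudo-inverse `q♯(s) = inf {t ≥ 0 : μ_q(t) ≤ s}`, with values in `[0, +∞]`. -/
def sharp (Ω : Set (EuclideanSpace ℝ (Fin d))) (q : EuclideanSpace ℝ (Fin d) → ℝ) (s : ℝ≥0∞) :
    ℝ≥0∞ :=
  sInf ((fun t : ℝ≥0 => (t : ℝ≥0∞)) '' {t : ℝ≥0 | distrib Ω q t ≤ s})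

/-- The rearrangement `q*(x) = q♯(meas (B(0,|x|) ∩ Ω))`. The value `q♯ = +∞`, which is possible
only on a null set, is replaced by `0`. -/
def rearr (Ω : Set (EuclideanSpace ℝ (Fin d))) (q : EuclideanSpace ℝ (Fin d) → ℝ)
    (x : EuclideanSpace ℝ (Fin d)) : ℝ :=
  (sharp Ω q (volume (Metric.ball (0 : EuclideanSpace ℝ (Fin d)) ‖x‖ ∩ Ω))).toReal

/-- `β_{f,g}(s) = meas {x ∈ Ω : f(x) ≤ s < g(x)}`. -/
def beta (Ω : Set (EuclideanSpace ℝ (Fin d))) (f g : EuclideanSpace ℝ (Fin d) → ℝ) (s : ℝ) :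
    ℝ≥0∞ :=
  volume {x | x ∈ Ω ∧ f x ≤ s ∧ s < g x}

/-- `a_σ(e) = meas {x ∈ Ω : σ(x) < e}`. -/
def jac (Ω : Set (EuclideanSpace ℝ (Fin d))) (σ : EuclideanSpace ℝ (Fin d) → ℝ) (e : ℝ) : ℝ≥0∞ :=
  volume {x | x ∈ Ω ∧ σ x < e}

/-- `e_min`, the essential infimum of `σ` on `Ω`. -/
def eMin (Ω : Set (EuclideanSpace ℝ (Fin d))) (σ : EuclideanSpace ℝ (Fin d) → ℝ) : EReal :=
  essInf (fun x => (σ x : EReal)) (volume.restrict Ω)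

/-- `e_max = sup {e ∈ ℝ : a_σ(e) < meas Ω}`. -/
def eMax (Ω : Set (EuclideanSpace ℝ (Fin d))) (σ : EuclideanSpace ℝ (Fin d) → ℝ) : EReal :=
  sSup ((fun e : ℝ => (e : EReal)) '' {e : ℝ | jac Ω σ e < volume Ω})

/-- The standing assumptions on `Ω` and `σ` under which the `σ`-rearrangement is defined.
Measurability is Lebesgue measurability. -/
structure Admissible (Ω : Set (EuclideanSpace ℝ (Fin d)))
    (σ : EuclideanSpace ℝ (Fin d) → ℝ) : Prop where
  measurable_domain : NullMeasurableSet Ω volume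
  measurable_fun : AEMeasurable σ (volume.restrict Ω)
  nonempty : {e : ℝ | jac Ω σ e < volume Ω}.Nonempty
  eMin_lt_eMax : eMin Ω σ < eMax Ω σ
  level_null : ∀ e : ℝ, (e : EReal) < eMax Ω σ → volume {x | x ∈ Ω ∧ σ x = e} = 0
  tendsto_jac : Tendsto (jac Ω σ)
    (comap (fun e : ℝ => (e : EReal)) (𝓝[<] (eMax Ω σ))) (𝓝 (volume Ω))

open Classical in
/-- The `σ`-rearrangement `q^{*σ}(x) = q♯(a_σ(σ(x))) 1_{σ(x) < e_max}`. The value `q♯ = +∞`, which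
is possible only on a null set, is replaced by `0`. -/
def sigmaRearr (Ω : Set (EuclideanSpace ℝ (Fin d))) (σ q : EuclideanSpace ℝ (Fin d) → ℝ)
    (x : EuclideanSpace ℝ (Fin d)) : ℝ :=
  if (σ x : EReal) < eMax Ω σ then (sharp Ω q (jac Ω σ (σ x))).toReal else 0

/-- The pseudo-inverse `b_σ(μ) = sup {t < e_max : a_σ(t) ≤ μ}`, equal to `-∞` if the set is
empty. -/
def jacInv (Ω : Set (EuclideanSpace ℝ (Fin d))) (σ : EuclideanSpace ℝ (Fin d) → ℝ) (μ : ℝ≥0∞) :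
    EReal :=
  sSup ((fun t : ℝ => (t : EReal)) '' {t : ℝ | (t : EReal) < eMax Ω σ ∧ jac Ω σ t ≤ μ})

/-- The set `{x ∈ Ω : a_σ(σ(x)) < μ}`. -/
def sublevel (Ω : Set (EuclideanSpace ℝ (Fin d))) (σ : EuclideanSpace ℝ (Fin d) → ℝ) (μ : ℝ≥0∞) :
    Set (EuclideanSpace ℝ (Fin d)) :=
  {x | x ∈ Ω ∧ jac Ω σ (σ x) < μ}

/-- `B_σ(μ) = ∫_{a_σ(σ(x)) < μ} σ(x) dx` for `0 ≤ μ < meas Ω`. -/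
def bigB (Ω : Set (EuclideanSpace ℝ (Fin d))) (σ : EuclideanSpace ℝ (Fin d) → ℝ) (μ : ℝ≥0∞) : ℝ :=
  ∫ x in sublevel Ω σ μ, σ x

open Classical in
/-- `B_σ` on all of `[0, +∞)`. If `meas Ω` is finite, `B_σ` is continued to `μ ≥ meas Ω` by
`∫_Ω σ + e_max (μ - meas Ω)`, that is, with slope `b_σ(μ) = e_max` there. Nothing is added
if `meas Ω = +∞`. -/
def bigBExt (Ω : Set (EuclideanSpace ℝ (Fin d))) (σ : EuclideanSpace ℝ (Fin d) → ℝ) (μ : ℝ≥0∞) :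
    EReal :=
  if μ < volume Ω then (bigB Ω σ μ : EReal)
  else extIntegral (volume.restrict Ω) (fun x => (σ x : EReal))
    + eMax Ω σ * ((μ - volume Ω : ℝ≥0∞) : EReal)

/-- `B_σ(μ + s) + B_σ(μ - s) - 2 B_σ(μ)`, for `0 ≤ s ≤ μ`. -/
def secondDiff (Ω : Set (EuclideanSpace ℝ (Fin d))) (σ : EuclideanSpace ℝ (Fin d) → ℝ)
    (μ s : ℝ≥0∞) : EReal :=
  bigBExt Ω σ (μ + s) + bigBExt Ω σ (μ - s) - 2 * bigBExt Ω σ μ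

/-- `H_σ(μ) = inf_{0 < s ≤ μ} (B_σ(μ + s) + B_σ(μ - s) - 2 B_σ(μ)) / s²`. -/
def bigH (Ω : Set (EuclideanSpace ℝ (Fin d))) (σ : EuclideanSpace ℝ (Fin d) → ℝ) (μ : ℝ≥0∞) :
    EReal :=
  ⨅ s ∈ Ioc (0 : ℝ≥0∞) μ, secondDiff Ω σ μ s / ((s : EReal) ^ 2)

/-- `K(q*, σ) = 4 ∫_0^{‖q‖_∞} dt / H_σ(μ_q(t))` in `[0, +∞]`, with `1/0 = +∞` and `1/(+∞) = 0`. -/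
def bigK (Ω : Set (EuclideanSpace ℝ (Fin d))) (σ q : EuclideanSpace ℝ (Fin d) → ℝ) : ℝ≥0∞ :=
  4 * ∫⁻ t in {t : ℝ | 0 < t ∧ ENNReal.ofReal t < eLpNorm q ⊤ (volume.restrict Ω)},
    ((bigH Ω σ (distrib Ω q t)).toENNReal)⁻¹

/-- The integrand `β_{f*,q*}(s) b_σ(2 μ_q(s)) - β_{q*,f*}(s) b_σ(μ_q(s))`. At most one of the two
factors `β` is nonzero, and `0 · (±∞) = 0`. -/
def correction (Ω : Set (EuclideanSpace ℝ (Fin d))) (σ f q : EuclideanSpace ℝ (Fin d) → ℝ)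
    (s : ℝ) : EReal :=
  (beta Ω (rearr Ω f) (rearr Ω q) s : EReal) * jacInv Ω σ (2 * distrib Ω q s)
    - (beta Ω (rearr Ω q) (rearr Ω f) s : EReal) * jacInv Ω σ (distrib Ω q s)

/-- The integrand `σ(x) (f(x) - q^{*σ}(x))`. -/
def energyDiff (Ω : Set (EuclideanSpace ℝ (Fin d))) (σ f q : EuclideanSpace ℝ (Fin d) → ℝ)
    (x : EuclideanSpace ℝ (Fin d)) : EReal :=
  ((σ x * (f x - sigmaRearr Ω σ q x) : ℝ) : EReal)

/-- `f` is a nonnegative element of `L¹(Ω)`. -/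
def NonnegL1 (Ω : Set (EuclideanSpace ℝ (Fin d))) (f : EuclideanSpace ℝ (Fin d) → ℝ) : Prop :=
  IntegrableOn f Ω volume ∧ 0 ≤ᵐ[volume.restrict Ω] f

/-- The norm of `L¹(Ω)`. -/
def normL1 (Ω : Set (EuclideanSpace ℝ (Fin d))) (f : EuclideanSpace ℝ (Fin d) → ℝ) : ℝ :=
  ∫ x in Ω, |f x|

end

end RefinedHL

open RefinedHL

/-!
Let `F e = ∫ (e - σ)₊`. On `[0, ∞)`, the extended `B_σ` is the Legendre transform of `F` on
`(-∞, e_max)`. It is therefore convex, and the bathtub principle `B_σ (meas A) ≤ ∫_A σ` is Young's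
inequality, with equality if `A` is a sublevel set of `σ`.

The set `G = {q^{*σ} > s}` is such a sublevel set and has measure `m = μ_q s`, so `∫_G σ = B_σ m`.
With `A = {f > s}`, the sets `A ∩ G` and `A ∪ G` have measures `m - β` and `m + β'`, where `β` is
`β_{f,q^{*σ}} s` and `β'` is `β_{q^{*σ},f} s`. The bathtub principle for both sets bounds
`∫_A σ - ∫_G σ` from below by `B_σ (m + β') + B_σ (m - β) - 2 B_σ m`. Replacing `β'` by `β` moves
along `B_σ` from `m + β'` to `m + β`, and the slopes of `B_σ` on that segment are controlled by
`b_σ m` and `b_σ (2m)`, which is the correction term. Integrating over `s` gives the inequality of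
part (iii).

Finally `‖f - q^{*σ}‖ + ‖q‖ - ‖f‖ = 2 ∫ β`, and `H_σ m * β ^ 2` is at most the second difference of
`B_σ`, so part (ii) follows from part (iii) by the Cauchy-Schwarz inequality.
-/

namespace RefinedHL

section Rank

variable {α : Type*} [MeasurableSpace α] {ν : Measure α} {ρ : α → ℝ} {T : α → ℝ≥0∞}
  {m : ℝ≥0∞} {c e : ℝ}

lemma monotone_measure_lt : Monotone fun t : ℝ => ν {x | ρ x < t} :=
  fun _ _ hst => measure_mono fun _ hx => lt_of_lt_of_le hx hst

lemma measure_lt_le_of_forall (h : ∀ t < c, ν {x | ρ x < t} ≤ m) : ν {x | ρ x < c} ≤ m := by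
  obtain ⟨u, hu, hlt, hlim⟩ := exists_seq_strictMono_tendsto c
  have hset : {x | ρ x < c} = ⋃ n, {x | ρ x < u n} := by
    ext x
    simp only [mem_ofPred_eq, mem_iUnion]
    exact ⟨fun hx => (hlim.eventually (lt_mem_nhds hx)).exists, fun ⟨n, hn⟩ => hn.trans (hlt n)⟩
  have hmono : Monotone fun n => {x | ρ x < u n} :=
    fun i j hij x (hx : ρ x < u i) => lt_of_lt_of_le hx (hu.monotone hij)
  rw [hset, hmono.measure_iUnion]
  exact iSup_le fun n => h _ (hlt n)

lemma le_measure_le_of_forall (hρ : AEMeasurable ρ ν) (hce : c < e)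
    (hfin : ν {x | ρ x < e} ≠ ⊤) (h : ∀ t, c < t → m ≤ ν {x | ρ x < t}) :
    m ≤ ν {x | ρ x ≤ c} := by
  obtain ⟨u, hu, hlt, hlim⟩ := exists_seq_strictAnti_tendsto' hce
  have hset : {x | ρ x ≤ c} = ⋂ n, {x | ρ x < u n} := by
    ext x
    simp only [mem_ofPred_eq, mem_iInter]
    exact ⟨fun hx n => lt_of_le_of_lt hx (hlt n).1,
      fun hx => ge_of_tendsto' hlim fun n => (hx n).le⟩
  have hanti : Antitone fun n => {x | ρ x < u n} :=
    fun i j hij x (hx : ρ x < u j) => lt_of_lt_of_le hx (hu.antitone hij)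
  rw [hset, hanti.measure_iInter (fun n => nullMeasurableSet_lt hρ aemeasurable_const)
    ⟨0, ne_top_of_le_ne_top hfin (monotone_measure_lt (hlt 0).2.le)⟩]
  exact le_iInf fun n => h _ (hlt n).1

lemma exists_measure_lt_lt (hρ : AEMeasurable ρ ν) (hm : m ≠ 0) (hfin : ν {x | ρ x < e} ≠ ⊤) :
    ∃ t, ν {x | ρ x < t} < m := by
  have hanti : Antitone fun n : ℕ => {x | ρ x < e - n} := fun i j hij x (hx : ρ x < e - j) =>
    hx.trans_le (by gcongr)
  have hset : ⋂ n : ℕ, {x | ρ x < e - n} = ∅ := by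
    refine eq_empty_of_forall_notMem fun x hx => ?_
    obtain ⟨n, hn⟩ := exists_nat_ge (e - ρ x)
    have : ρ x < e - n := mem_iInter.1 hx n
    linarith
  have hlim := tendsto_measure_iInter_atTop (μ := ν)
    (fun n : ℕ => nullMeasurableSet_lt hρ (aemeasurable_const (b := e - (n : ℝ)))) hanti
    ⟨0, by simpa using hfin⟩
  rw [hset, measure_empty] at hlim
  obtain ⟨n, hn⟩ := (hlim.eventually (gt_mem_nhds (pos_iff_ne_zero.2 hm))).exists
  exact ⟨e - n, hn⟩

lemma exists_forall_lt_measure_lt (hρ : AEMeasurable ρ ν) (hm : m ≠ 0)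
    (hme : m < ν {x | ρ x < e}) (hfin : ν {x | ρ x < e} ≠ ⊤) :
    ∃ c, (∀ t < c, ν {x | ρ x < t} < m) ∧ ∀ t, c < t → m ≤ ν {x | ρ x < t} := by
  set G : Set ℝ := {t | ν {x | ρ x < t} < m}
  have hne : G.Nonempty := exists_measure_lt_lt hρ hm hfin
  have hbdd : BddAbove G := ⟨e, fun t ht =>
    le_of_not_ge fun h => (hme.trans_le (monotone_measure_lt h)).not_gt ht⟩
  refine ⟨sSup G, fun t ht => ?_, fun t ht => ?_⟩
  · obtain ⟨g, hg, htg⟩ := exists_lt_of_lt_csSup hne ht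
    exact (monotone_measure_lt htg.le).trans_lt hg
  · by_contra! h
    exact (le_csSup hbdd h).not_gt ht

lemma ae_eq_setOf_lt_setOf_le (h : ν {x | ρ x = c} = 0) :
    {x | ρ x < c} =ᵐ[ν] {x | ρ x ≤ c} := by
  have : {x | ρ x ≤ c} = {x | ρ x < c} ∪ {x | ρ x = c} := by
    ext x
    simp only [mem_ofPred_eq, mem_union, le_iff_lt_or_eq]
  rw [this]
  exact (union_ae_eq_left_of_ae_eq_empty (ae_eq_empty.2 h)).symm

lemma exists_measure_lt_eq (hρ : AEMeasurable ρ ν) (hm : m ≠ 0) (hme : m < ν {x | ρ x < e})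
    (hfin : ν {x | ρ x < e} ≠ ⊤) (hlev : ∀ t < e, ν {x | ρ x = t} = 0) :
    ∃ c < e, ν {x | ρ x < c} = m ∧ {x | ν {y | ρ y < ρ x} < m} =ᵐ[ν] {x | ρ x < c} := by
  obtain ⟨c, hlt, hge⟩ := exists_forall_lt_measure_lt hρ hm hme hfin
  have hle : ν {x | ρ x < c} ≤ m := measure_lt_le_of_forall fun t ht => (hlt t ht).le
  have hce : c < e := by
    by_contra! h
    exact (hme.trans_le (monotone_measure_lt h)).not_ge hle
  have hae := ae_eq_setOf_lt_setOf_le (hlev c hce)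
  refine ⟨c, hce, hle.antisymm ?_, ?_⟩
  · rw [measure_congr hae]
    exact le_measure_le_of_forall hρ hce hfin hge
  · have hsub : {x | ρ x < c} ⊆ {x | ν {y | ρ y < ρ x} < m} := fun x hx => hlt _ hx
    have hsup : {x | ν {y | ρ y < ρ x} < m} ⊆ {x | ρ x ≤ c} :=
      fun x hx => le_of_not_gt fun h => (hge _ h).not_gt hx
    exact (hsup.eventuallyLE.trans hae.symm.le).antisymm hsub.eventuallyLE

/-- `T` is a rank function for `ν` if it transports `ν` to Lebesgue measure on `[0, ν univ]`. Both
`x ↦ meas (B(0,|x|) ∩ Ω)` and `x ↦ a_σ(σ(x))` are rank functions, which is all that the two kinds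
of rearrangement use. -/
structure IsRank (T : α → ℝ≥0∞) (ν : Measure α) : Prop where
  aemeasurable : AEMeasurable T ν
  measure_lt : ∀ m ≤ ν univ, ν {x | T x < m} = m

lemma isRank_measure_lt (hρ : AEMeasurable ρ ν)
    (h : ∀ m < ν univ, ∃ e, m < ν {x | ρ x < e} ∧ ν {x | ρ x < e} ≠ ⊤ ∧
      ∀ t < e, ν {x | ρ x = t} = 0) :
    IsRank (fun x => ν {y | ρ y < ρ x}) ν := by
  refine ⟨monotone_measure_lt.measurable.comp_aemeasurable hρ, fun m hm => ?_⟩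
  have of_lt : ∀ m < ν univ, ν {x | ν {y | ρ y < ρ x} < m} = m := fun m hm => by
    rcases eq_or_ne m 0 with rfl | hm0
    · simp only [not_lt_zero, ofPred_false, measure_empty]
    · obtain ⟨e, hme, hfin, hlev⟩ := h m hm
      obtain ⟨c, -, hc, hae⟩ := exists_measure_lt_eq hρ hm0 hme hfin hlev
      rw [measure_congr hae, hc]
  rcases hm.lt_or_eq with hm | rfl
  · exact of_lt m hm
  · refine (measure_mono (subset_univ _)).antisymm (le_of_forall_lt fun m hm => ?_)
    obtain ⟨m', hmm', hm'⟩ := exists_between hm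
    calc m < ν {x | ν {y | ρ y < ρ x} < m'} := by rwa [of_lt m' hm']
      _ ≤ ν {x | ν {y | ρ y < ρ x} < ν univ} := measure_mono fun x hx => lt_trans hx hm'

namespace IsRank

lemma ae_pos (hT : IsRank T ν) : ∀ᵐ x ∂ν, 0 < T x := by
  refine ae_iff.2 (nonpos_iff_eq_zero.1 (le_of_forall_gt fun m hm => ?_))
  rcases eq_or_ne (ν univ) 0 with h0 | h0
  · rwa [measure_mono_null (subset_univ _) h0]
  · obtain ⟨m', hm', hlt⟩ := exists_between (lt_min hm (pos_iff_ne_zero.2 h0))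
    calc ν {x | ¬ 0 < T x} ≤ ν {x | T x < m'} :=
          measure_mono fun x hx => (not_lt.1 hx).trans_lt hm'
      _ = m' := hT.measure_lt m' (hlt.le.trans (min_le_right _ _))
      _ < m := hlt.trans_le (min_le_left _ _)

lemma measure_sdiff (hT : IsRank T ν) {a b : ℝ≥0∞} (ha : a ≤ ν univ) (hb : b ≤ ν univ) :
    ν ({x | T x < b} \ {x | T x < a}) = b - a := by
  rcases le_or_gt b a with hba | hab
  · have hsub : {x | T x < b} ⊆ {x | T x < a} := fun x hx => lt_of_lt_of_le hx hba
    rw [tsub_eq_zero_of_le hba, sdiff_eq_empty.2 hsub, measure_empty]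
  · have hsub : {x | T x < a} ⊆ {x | T x < b} := fun x hx => lt_trans hx hab
    rw [MeasureTheory.measure_sdiff hsub (nullMeasurableSet_lt hT.aemeasurable aemeasurable_const),
      hT.measure_lt a ha, hT.measure_lt b hb]
    rw [hT.measure_lt a ha]
    exact hab.ne_top

end IsRank

end Rank

section Shortfall

variable {α : Type*} [MeasurableSpace α] {ν : Measure α} {σ : α → ℝ} {E : EReal}

/-- The integral `∫ (e - σ)₊ dν`. Its one-sided derivatives in `e` are `ν {σ < e}` and
`ν {σ ≤ e}`. -/
noncomputable def shortfall (ν : Measure α) (σ : α → ℝ) (e : ℝ) : ℝ :=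
  ∫ x, max (e - σ x) 0 ∂ν

/-- The Legendre transform of `shortfall ν σ` on `(-∞, E)`. With `E = e_max` it is the extension
of `B_σ` to `[0, ∞)`. -/
noncomputable def shortfallConj (ν : Measure α) (σ : α → ℝ) (E : EReal) (x : ℝ) : EReal :=
  ⨆ e : {e : ℝ // (e : EReal) < E}, ((e * x - shortfall ν σ e : ℝ) : EReal)

lemma le_shortfallConj {e : ℝ} (he : (e : EReal) < E) (x : ℝ) :
    ((e * x - shortfall ν σ e : ℝ) : EReal) ≤ shortfallConj ν σ E x :=
  le_iSup (fun e : {e : ℝ // (e : EReal) < E} => ((e * x - shortfall ν σ e : ℝ) : EReal)) ⟨e, he⟩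

lemma shortfallConj_le {x : ℝ} {c : EReal}
    (h : ∀ e : ℝ, (e : EReal) < E → ((e * x - shortfall ν σ e : ℝ) : EReal) ≤ c) :
    shortfallConj ν σ E x ≤ c :=
  iSup_le fun e => h e e.2

lemma measurable_shortfallConj : Measurable (shortfallConj ν σ E) :=
  (lowerSemicontinuous_iSup fun _ =>
    (continuous_coe_real_ereal.comp (by fun_prop)).lowerSemicontinuous).measurable

lemma shortfallConj_convex {x y p q a b : ℝ} (hx : shortfallConj ν σ E x ≤ p)
    (hy : shortfallConj ν σ E y ≤ q) (ha : 0 ≤ a) (hb : 0 ≤ b) (hab : a + b = 1) :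
    shortfallConj ν σ E (a * x + b * y) ≤ ((a * p + b * q : ℝ) : EReal) := by
  refine shortfallConj_le fun e he => EReal.coe_le_coe_iff.2 ?_
  have hp : e * x - shortfall ν σ e ≤ p := EReal.coe_le_coe_iff.1 ((le_shortfallConj he x).trans hx)
  have hq : e * y - shortfall ν σ e ≤ q := EReal.coe_le_coe_iff.1 ((le_shortfallConj he y).trans hy)
  calc e * (a * x + b * y) - shortfall ν σ e
      = a * (e * x - shortfall ν σ e) + b * (e * y - shortfall ν σ e) := by
        linear_combination shortfall ν σ e * hab
    _ ≤ a * p + b * q := by gcongr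

/-- All the truncations `(e - σ)₊` with `e < E` are integrable. -/
structure IntegrableBelow (ν : Measure α) (σ : α → ℝ) (E : EReal) : Prop where
  aemeasurable : AEMeasurable σ ν
  bot_lt : ⊥ < E
  integrable : ∀ e : ℝ, (e : EReal) < E → Integrable (fun x => max (e - σ x) 0) ν

namespace IntegrableBelow

variable {A : Set α} {e c x : ℝ}

lemma exists_lt (hσ : IntegrableBelow ν σ E) : ∃ e : ℝ, (e : EReal) < E :=
  (EReal.lt_iff_exists_real_btwn.1 hσ.bot_lt).imp fun _ h => h.2

lemma nullMeasurableSet_lt (hσ : IntegrableBelow ν σ E) (e : ℝ) :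
    NullMeasurableSet {x | σ x < e} ν :=
  _root_.nullMeasurableSet_lt hσ.aemeasurable aemeasurable_const

lemma measure_lt_ne_top (hσ : IntegrableBelow ν σ E) (he : (e : EReal) < E) :
    ν {x | σ x < e} ≠ ⊤ := by
  obtain ⟨t, het, htE⟩ := EReal.lt_iff_exists_real_btwn.1 he
  have het : 0 < t - e := sub_pos.2 (EReal.coe_lt_coe_iff.1 het)
  refine ne_top_of_le_ne_top ((hσ.integrable t htE).measure_gt_lt_top het).ne
    (measure_mono fun x (hx : σ x < e) => ?_)
  exact lt_max_of_lt_left (sub_lt_sub_left hx t)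

lemma integrableOn_lt (hσ : IntegrableBelow ν σ E) (he : (e : EReal) < E) :
    IntegrableOn σ {x | σ x < e} ν := by
  have hconst : IntegrableOn (fun _ => e) {x | σ x < e} ν :=
    integrableOn_const (hσ.measure_lt_ne_top he)
  refine (hconst.sub (hσ.integrable e he).integrableOn).congr_fun_ae ?_
  filter_upwards [ae_restrict_mem₀ (hσ.nullMeasurableSet_lt e)] with x (hx : σ x < e)
  rw [Pi.sub_apply, max_eq_left (sub_pos.2 hx).le, sub_sub_cancel]

lemma shortfall_add_le (hσ : IntegrableBelow ν σ E) {t : ℝ} (he : (e : EReal) < E)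
    (ht : (t : EReal) < E) :
    shortfall ν σ e + (t - e) * ν.real {x | σ x < e} ≤ shortfall ν σ t := by
  have hind : Integrable ({x | σ x < e}.indicator fun _ => t - e) ν :=
    (integrableOn_const (hσ.measure_lt_ne_top he)).integrable_indicator₀ (hσ.nullMeasurableSet_lt e)
  calc shortfall ν σ e + (t - e) * ν.real {x | σ x < e}
      = ∫ x, (max (e - σ x) 0 + {x | σ x < e}.indicator (fun _ => t - e) x) ∂ν := by
        rw [integral_add (hσ.integrable e he) hind,
          integral_indicator₀ (hσ.nullMeasurableSet_lt e), setIntegral_const, smul_eq_mul,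
          mul_comm, shortfall]
    _ ≤ shortfall ν σ t := by
        refine integral_mono ((hσ.integrable e he).add hind) (hσ.integrable t ht) fun x => ?_
        by_cases hx : σ x < e
        · have hmem : x ∈ {x | σ x < e} := hx
          simp only [indicator_of_mem hmem, max_eq_left (sub_pos.2 hx).le]
          linarith [le_max_left (t - σ x) 0]
        · have hmem : x ∉ {x | σ x < e} := hx
          simp only [indicator_of_notMem hmem, max_eq_right (sub_nonpos.2 (not_lt.1 hx)), add_zero,
            le_max_right]

lemma bot_lt_shortfallConj (hσ : IntegrableBelow ν σ E) (x : ℝ) : ⊥ < shortfallConj ν σ E x := by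
  obtain ⟨e, he⟩ := hσ.exists_lt
  exact (EReal.bot_lt_coe _).trans_le (le_shortfallConj he x)

lemma shortfallConj_le_setIntegral (hσ : IntegrableBelow ν σ E) (hA : ν A ≠ ⊤)
    (hi : IntegrableOn σ A ν) :
    shortfallConj ν σ E (ν.real A) ≤ ((∫ x in A, σ x ∂ν : ℝ) : EReal) := by
  refine shortfallConj_le fun e he => EReal.coe_le_coe_iff.2 ?_
  have hconst : IntegrableOn (fun _ => e) A ν := integrableOn_const hA
  have hle : ∫ x in A, (e - σ x) ∂ν ≤ shortfall ν σ e :=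
    (integral_mono (hconst.sub hi) (hσ.integrable e he).integrableOn
      fun _ => le_max_left _ _).trans
      (setIntegral_le_integral (hσ.integrable e he)
        (Eventually.of_forall fun _ => le_max_right _ _))
  rw [integral_sub hconst hi, setIntegral_const, smul_eq_mul, mul_comm] at hle
  linarith

lemma setIntegral_lt (hσ : IntegrableBelow ν σ E) (hc : (c : EReal) < E) :
    ∫ x in {x | σ x < c}, σ x ∂ν = c * ν.real {x | σ x < c} - shortfall ν σ c := by
  have hshort : shortfall ν σ c = ∫ x in {x | σ x < c}, (c - σ x) ∂ν := by
    rw [shortfall, ← setIntegral_eq_integral_of_forall_compl_eq_zero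
      fun x hx => max_eq_right (sub_nonpos.2 (not_lt.1 hx))]
    exact setIntegral_congr_fun₀ (hσ.nullMeasurableSet_lt c)
      fun x (hx : σ x < c) => max_eq_left (sub_pos.2 hx).le
  have hconst : IntegrableOn (fun _ => c) {x | σ x < c} ν :=
    integrableOn_const (hσ.measure_lt_ne_top hc)
  rw [hshort, integral_sub hconst (hσ.integrableOn_lt hc), setIntegral_const, smul_eq_mul, mul_comm,
    sub_sub_cancel]

lemma shortfallConj_measure_lt (hσ : IntegrableBelow ν σ E) (hc : (c : EReal) < E) :
    shortfallConj ν σ E (ν.real {x | σ x < c}) = ((∫ x in {x | σ x < c}, σ x ∂ν : ℝ) : EReal) := by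
  refine le_antisymm
    (hσ.shortfallConj_le_setIntegral (hσ.measure_lt_ne_top hc) (hσ.integrableOn_lt hc)) ?_
  rw [hσ.setIntegral_lt hc]
  exact le_shortfallConj hc _

lemma exists_shortfall_lt (hσ : IntegrableBelow ν σ E) {ε : ℝ} (hε : 0 < ε) :
    ∃ e : ℝ, (e : EReal) < E ∧ shortfall ν σ e < ε := by
  obtain ⟨e, he⟩ := hσ.exists_lt
  have hle : ∀ n : ℕ, e - n ≤ e := fun n => sub_le_self e n.cast_nonneg
  have hlim : Tendsto (fun n : ℕ => shortfall ν σ (e - n)) atTop (𝓝 (∫ _, (0 : ℝ) ∂ν)) := by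
    refine tendsto_integral_of_dominated_convergence (fun x => max (e - σ x) 0)
      (fun n => ?_) (hσ.integrable e he) (fun n => Eventually.of_forall fun x => ?_)
      (Eventually.of_forall fun x => ?_)
    · exact ((aemeasurable_const.sub hσ.aemeasurable).max aemeasurable_const).aestronglyMeasurable
    · rw [Real.norm_of_nonneg (le_max_right _ _)]
      exact max_le_max_right _ (sub_le_sub_right (hle n) _)
    · refine tendsto_const_nhds.congr' ?_
      obtain ⟨N, hN⟩ := exists_nat_ge (e - σ x)
      filter_upwards [eventually_ge_atTop N] with n hn
      have : (N : ℝ) ≤ n := by exact_mod_cast hn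
      exact (max_eq_right (by linarith)).symm
  rw [integral_zero] at hlim
  obtain ⟨n, hn⟩ := (hlim.eventually (gt_mem_nhds hε)).exists
  exact ⟨e - n, (EReal.coe_le_coe_iff.2 (hle n)).trans_lt he, hn⟩

lemma shortfallConj_zero (hσ : IntegrableBelow ν σ E) : shortfallConj ν σ E 0 = 0 := by
  refine le_antisymm (shortfallConj_le fun e _ => ?_)
    (EReal.ge_of_forall_gt_iff_ge.1 fun z hz => ?_)
  · rw [mul_zero, zero_sub]
    exact_mod_cast neg_nonpos.2 (integral_nonneg fun _ => le_max_right _ _)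
  · have hz : z < 0 := by exact_mod_cast hz
    obtain ⟨e, he, hlt⟩ := hσ.exists_shortfall_lt (neg_pos.2 hz)
    exact (EReal.coe_le_coe_iff.2 (by linarith)).trans (le_shortfallConj he 0)

lemma lintegral_neg_ne_top (hσ : IntegrableBelow ν σ E) (hA : ν A ≠ ⊤) :
    ∫⁻ x in A, ENNReal.ofReal (-σ x) ∂ν ≠ ⊤ := by
  obtain ⟨e, he⟩ := hσ.exists_lt
  have hi : IntegrableOn (fun x => max (e - σ x) 0 + |e|) A ν :=
    (hσ.integrable e he).integrableOn.add (integrableOn_const hA)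
  refine ne_top_of_le_ne_top hi.lintegral_lt_top.ne
    (lintegral_mono fun x => ENNReal.ofReal_le_ofReal ?_)
  linarith [le_max_left (e - σ x) 0, neg_le_abs e]

end IntegrableBelow

end Shortfall

section ExtIntegral

variable {α : Type*} [MeasurableSpace α] {ν : Measure α}

lemma extIntegral_coe {g : α → ℝ} (hg : Integrable g ν) :
    extIntegral ν (fun x => (g x : EReal)) = ((∫ x, g x ∂ν : ℝ) : EReal) := by
  rw [extIntegral, integral_eq_lintegral_pos_part_sub_lintegral_neg_part hg, EReal.coe_sub,
    EReal.coe_ennreal_toReal hg.lintegral_lt_top.ne, EReal.coe_ennreal_toReal]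
  exacts [rfl, hg.neg.lintegral_lt_top.ne]

lemma extIntegral_ne_bot {g : α → EReal} (h : ∫⁻ x, (-g x).toENNReal ∂ν ≠ ⊤) :
    extIntegral ν g ≠ ⊥ := by
  rw [extIntegral, sub_eq_add_neg, Ne, EReal.add_eq_bot_iff, not_or, EReal.neg_eq_bot_iff,
    EReal.coe_ennreal_eq_top_iff]
  exact ⟨EReal.coe_ennreal_ne_bot _, h⟩

lemma extIntegral_ne_top {g : α → EReal}
    (hg : PosPartIntegrable ν g) : extIntegral ν g ≠ ⊤ := by
  refine ((EReal.sub_le_sub le_rfl (EReal.coe_ennreal_nonneg _)).trans_lt ?_).ne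
  rw [sub_zero]
  exact lt_top_iff_ne_top.2 (EReal.coe_ennreal_eq_top_iff.not.2 hg)

lemma extIntegral_neg {g : α → EReal}
    (hg : PosPartIntegrable ν g) : extIntegral ν (fun x => -g x) = -extIntegral ν g := by
  have hbot : ∀ a : ℝ≥0∞, (a : EReal) ≠ ⊥ := EReal.coe_ennreal_ne_bot
  rw [extIntegral, extIntegral, EReal.neg_sub (.inl (hbot _))
    (.inl (EReal.coe_ennreal_eq_top_iff.not.2 hg)), sub_eq_add_neg, add_comm]
  simp only [neg_neg]

lemma integrable_of_lintegral_ofReal_ne_top {g : α → ℝ} (hg : AEMeasurable g ν)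
    (hpos : ∫⁻ x, ENNReal.ofReal (g x) ∂ν ≠ ⊤) (hneg : ∫⁻ x, ENNReal.ofReal (-g x) ∂ν ≠ ⊤) :
    Integrable g ν := by
  refine ⟨hg.aestronglyMeasurable, ?_⟩
  calc ∫⁻ x, ‖g x‖ₑ ∂ν
      ≤ ∫⁻ x, (ENNReal.ofReal (g x) + ENNReal.ofReal (-g x)) ∂ν := lintegral_mono fun x => by
        rw [Real.enorm_eq_ofReal_abs]
        rcases abs_choice (g x) with h | h <;> rw [h]
        exacts [le_self_add, le_add_self]
    _ = ∫⁻ x, ENNReal.ofReal (g x) ∂ν + ∫⁻ x, ENNReal.ofReal (-g x) ∂ν :=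
        lintegral_add_left' hg.ennreal_ofReal _
    _ < ⊤ := ENNReal.add_lt_top.2 ⟨hpos.lt_top, hneg.lt_top⟩

lemma integrable_of_extIntegral_ne_top {g : α → ℝ} (hg : AEMeasurable g ν)
    (hneg : ∫⁻ x, ENNReal.ofReal (-g x) ∂ν ≠ ⊤)
    (h : extIntegral ν (fun x => (g x : EReal)) ≠ ⊤) : Integrable g ν := by
  refine integrable_of_lintegral_ofReal_ne_top hg (fun hpos => h ?_) hneg
  have hpos : ∫⁻ x, (g x : EReal).toENNReal ∂ν = ⊤ := hpos
  have hneg : ∫⁻ x, (-(g x : EReal)).toENNReal ∂ν ≠ ⊤ := hneg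
  rw [extIntegral, hpos, EReal.coe_ennreal_top, ← EReal.coe_ennreal_toReal hneg]
  exact EReal.top_sub_coe _

lemma tendsto_extIntegral_of_monotone {g : ℕ → α → EReal} {G : α → EReal}
    (hmeas : ∀ n, AEMeasurable (g n) ν) (hmono : ∀ᵐ x ∂ν, Monotone fun n => g n x)
    (hlim : ∀ᵐ x ∂ν, Tendsto (fun n => g n x) atTop (𝓝 (G x)))
    (hneg : ∫⁻ x, (-g 0 x).toENNReal ∂ν ≠ ⊤) :
    Tendsto (fun n => extIntegral ν (g n)) atTop (𝓝 (extIntegral ν G)) := by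
  have hpos_lim : Tendsto (fun n => ∫⁻ x, (g n x).toENNReal ∂ν) atTop
      (𝓝 (∫⁻ x, (G x).toENNReal ∂ν)) := by
    refine lintegral_tendsto_of_tendsto_of_monotone (fun n => (hmeas n).ereal_toENNReal) ?_ ?_
    · filter_upwards [hmono] with x hx i j hij
      exact EReal.toENNReal_le_toENNReal (hx hij)
    · filter_upwards [hlim] with x hx
      exact (EReal.continuous_toENNReal.tendsto _).comp hx
  have hneg_lim : Tendsto (fun n => ∫⁻ x, (-g n x).toENNReal ∂ν) atTop
      (𝓝 (∫⁻ x, (-G x).toENNReal ∂ν)) := by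
    refine lintegral_tendsto_of_tendsto_of_antitone
      (fun n => (measurable_neg.comp_aemeasurable (hmeas n)).ereal_toENNReal) ?_ hneg ?_
    · filter_upwards [hmono] with x hx i j hij
      exact EReal.toENNReal_le_toENNReal (EReal.neg_le_neg_iff.2 (hx hij))
    · filter_upwards [hlim] with x hx
      exact (EReal.continuous_toENNReal.tendsto _).comp ((continuous_neg.tendsto _).comp hx)
  have hne : ∫⁻ x, (-G x).toENNReal ∂ν ≠ ⊤ := by
    refine ne_top_of_le_ne_top hneg (lintegral_mono_ae ?_)
    filter_upwards [hmono, hlim] with x hmono hlim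
    exact EReal.toENNReal_le_toENNReal (EReal.neg_le_neg_iff.2 (hmono.ge_of_tendsto hlim 0))
  have hcoe := continuous_coe_ennreal_ereal
  exact (EReal.continuousAt_add (.inr (by simpa using hne)) (.inl (EReal.coe_ennreal_ne_bot _))
    ).tendsto.comp (((hcoe.tendsto _).comp hpos_lim).prodMk_nhds
      ((continuous_neg.tendsto _).comp ((hcoe.tendsto _).comp hneg_lim)))

end ExtIntegral

section Extension

variable {α : Type*} [MeasurableSpace α] {ν : Measure α} {σ : α → ℝ} {E : EReal}

lemma min_eq_sub_max (e t : ℝ) : min e t = e - max (e - t) 0 := by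
  rcases le_total e t with h | h
  · rw [min_eq_left h, max_eq_right (sub_nonpos.2 h), sub_zero]
  · rw [min_eq_right h, max_eq_left (sub_nonneg.2 h), sub_sub_cancel]

lemma exists_seq_monotone_tendsto (hE : ⊥ < E) :
    ∃ u : ℕ → ℝ, Monotone u ∧ (∀ n, (u n : EReal) < E) ∧
      Tendsto (fun n => (u n : EReal)) atTop (𝓝 E) := by
  obtain ⟨v, hmono, hmem, hlim⟩ := exists_seq_strictMono_tendsto' hE
  have hcoe : ∀ n, ((v n).toReal : EReal) = v n := fun n =>
    EReal.coe_toReal ((hmem n).2.trans_le le_top).ne (hmem n).1.ne'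
  refine ⟨fun n => (v n).toReal, fun i j hij => ?_, fun n => ?_, ?_⟩
  · rw [← EReal.coe_le_coe_iff, hcoe, hcoe]
    exact hmono.monotone hij
  · rw [hcoe]
    exact (hmem n).2
  · simpa only [hcoe] using hlim

namespace IntegrableBelow

variable [IsFiniteMeasure ν] {x y e : ℝ} {u : ℕ → ℝ}

lemma tendsto_shortfallConj (hσ : IntegrableBelow ν σ E) (hx : ν.real univ ≤ x)
    (hu : ∀ n, (u n : EReal) < E) (hlim : Tendsto (fun n => (u n : EReal)) atTop (𝓝 E)) :
    Tendsto (fun n => ((u n * x - shortfall ν σ (u n) : ℝ) : EReal)) atTop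
      (𝓝 (shortfallConj ν σ E x)) := by
  refine tendsto_order.2 ⟨fun a ha => ?_, fun a ha =>
    Eventually.of_forall fun n => (le_shortfallConj (hu n) x).trans_lt ha⟩
  obtain ⟨⟨e, he⟩, hae⟩ := lt_iSup_iff.1 ha
  filter_upwards [hlim.eventually (lt_mem_nhds he)] with n hn
  have hen : e ≤ u n := (EReal.coe_lt_coe_iff.1 hn).le
  refine hae.trans_le (EReal.coe_le_coe_iff.2 ?_)
  have hsub := hσ.shortfall_add_le (hu n) he
  have hslope : (u n - e) * ν.real {x | σ x < u n} ≤ (u n - e) * x :=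
    mul_le_mul_of_nonneg_left ((measureReal_mono (subset_univ _)).trans hx) (sub_nonneg.2 hen)
  linarith

lemma integrable_min (hσ : IntegrableBelow ν σ E) (he : (e : EReal) < E) :
    Integrable (fun x => min e (σ x)) ν := by
  simp only [min_eq_sub_max]
  exact (integrable_const e).sub (hσ.integrable e he)

lemma extIntegral_min (hσ : IntegrableBelow ν σ E) (he : (e : EReal) < E) :
    extIntegral ν (fun x => ((min e (σ x) : ℝ) : EReal)) =
      ((e * ν.real univ - shortfall ν σ e : ℝ) : EReal) := by
  rw [extIntegral_coe (hσ.integrable_min he)]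
  simp only [min_eq_sub_max]
  rw [integral_sub (integrable_const e) (hσ.integrable e he), integral_const, smul_eq_mul, mul_comm,
    shortfall]

lemma tendsto_extIntegral_min (hσ : IntegrableBelow ν σ E) (hE : ∀ᵐ x ∂ν, (σ x : EReal) < E)
    (hmono : Monotone u) (hu : ∀ n, (u n : EReal) < E)
    (hlim : Tendsto (fun n => (u n : EReal)) atTop (𝓝 E)) :
    Tendsto (fun n => ((u n * ν.real univ - shortfall ν σ (u n) : ℝ) : EReal)) atTop
      (𝓝 (extIntegral ν fun x => (σ x : EReal))) := by
  simp only [← hσ.extIntegral_min (hu _)]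
  refine tendsto_extIntegral_of_monotone (fun n => ?_) (Eventually.of_forall fun x i j hij => ?_)
    ?_ ?_
  · exact measurable_coe_real_ereal.comp_aemeasurable (aemeasurable_const.min hσ.aemeasurable)
  · exact EReal.coe_le_coe_iff.2 (min_le_min_right _ (hmono hij))
  · filter_upwards [hE] with x hx
    refine tendsto_const_nhds.congr' ?_
    filter_upwards [hlim.eventually (lt_mem_nhds hx)] with n hn
    rw [min_eq_right (EReal.coe_lt_coe_iff.1 hn).le]
  · exact (hσ.integrable_min (hu 0)).neg.lintegral_lt_top.ne

lemma shortfallConj_univ_add (hσ : IntegrableBelow ν σ E) (hE : ∀ᵐ x ∂ν, (σ x : EReal) < E)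
    (hy : 0 ≤ y) : shortfallConj ν σ E (ν.real univ + y) =
      extIntegral ν (fun x => (σ x : EReal)) + E * y := by
  obtain ⟨u, hmono, hu, hlim⟩ := exists_seq_monotone_tendsto hσ.bot_lt
  have hint := hσ.tendsto_extIntegral_min hE hmono hu hlim
  refine tendsto_nhds_unique (hσ.tendsto_shortfallConj (le_add_of_nonneg_right hy) hu hlim) ?_
  rcases hy.eq_or_lt with rfl | hy
  · simpa only [add_zero, EReal.coe_zero, mul_zero] using hint
  have hy0 : (y : EReal) ≠ 0 := by exact_mod_cast hy.ne'
  have hmul : Tendsto (fun n => (u n : EReal) * y) atTop (𝓝 (E * y)) := by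
    have := (EReal.continuousAt_mul (p := (E, (y : EReal))) (.inr (EReal.coe_ne_bot y))
      (.inr (EReal.coe_ne_top y)) (.inr hy0) (.inr hy0)).tendsto
    exact this.comp (hlim.prodMk_nhds tendsto_const_nhds)
  have hmul_ne : E * y ≠ ⊥ := by
    refine ((EReal.bot_lt_coe (u 0 * y)).trans_le ?_).ne'
    rw [EReal.coe_mul]
    exact mul_le_mul_of_nonneg_right (hu 0).le (EReal.coe_nonneg.2 hy.le)
  have hint_ne : extIntegral ν (fun x => (σ x : EReal)) ≠ ⊥ := by
    have hneg := hσ.lintegral_neg_ne_top (measure_ne_top ν univ)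
    rw [setLIntegral_univ] at hneg
    exact extIntegral_ne_bot hneg
  refine ((EReal.continuousAt_add (.inr hmul_ne) (.inl hint_ne)).tendsto.comp
    (hint.prodMk_nhds hmul)).congr fun n => ?_
  rw [Function.comp_apply, ← EReal.coe_mul, ← EReal.coe_add]
  congr 1
  ring

end IntegrableBelow

end Extension

section Slopes

variable {α : Type*} [MeasurableSpace α] {ν : Measure α} {σ : α → ℝ} {E y s : EReal}
  {x x' c t δ : ℝ}

lemma le_coe_add_mul_of_forall_gt (hδ : 0 < δ)
    (h : ∀ t : ℝ, s < t → y ≤ ((c + δ * t : ℝ) : EReal)) : y ≤ c + δ * s := by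
  refine EReal.le_of_forall_lt_iff_le.1 fun z hz => ?_
  have hzc : c + δ * ((z - c) / δ) = z := by rw [mul_div_cancel₀ _ hδ.ne', add_sub_cancel]
  rw [← hzc]
  refine h _ (lt_of_not_ge fun hs => hz.not_ge ?_)
  rw [← hzc, EReal.coe_add, EReal.coe_mul]
  exact add_le_add_right (mul_le_mul_of_nonneg_left hs (EReal.coe_nonneg.2 hδ.le)) _

lemma le_coe_sub_mul_of_forall_lt (hδ : 0 < δ)
    (h : ∀ t : ℝ, (t : EReal) < s → y ≤ ((c - δ * t : ℝ) : EReal)) : y ≤ c - δ * s := by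
  rw [sub_eq_add_neg, ← mul_neg]
  refine le_coe_add_mul_of_forall_gt hδ fun t ht => ?_
  have := h (-t) (by rw [EReal.coe_neg]; exact EReal.neg_lt_comm.1 ht)
  rwa [mul_neg, sub_neg_eq_add] at this

namespace IntegrableBelow

lemma shortfallConj_le_sub (hσ : IntegrableBelow ν σ E) (hxx : x ≤ x') (ht : (t : EReal) < E)
    (htx : ν.real {a | σ a < t} ≤ x) (hc : shortfallConj ν σ E x' ≤ c) :
    shortfallConj ν σ E x ≤ ((c - (x' - x) * t : ℝ) : EReal) := by
  refine shortfallConj_le fun e he => EReal.coe_le_coe_iff.2 ?_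
  rcases le_total t e with hte | het
  · have hce := EReal.coe_le_coe_iff.1 ((le_shortfallConj he x').trans hc)
    have := mul_le_mul_of_nonneg_left hte (sub_nonneg.2 hxx)
    linarith
  · have hct := EReal.coe_le_coe_iff.1 ((le_shortfallConj ht x').trans hc)
    have hsub := hσ.shortfall_add_le ht he
    have := mul_le_mul_of_nonneg_left htx (sub_nonneg.2 het)
    linarith

lemma shortfallConj_le_add (hσ : IntegrableBelow ν σ E) (hxx : x ≤ x')
    (htx : (t : EReal) < E → x' ≤ ν.real {a | σ a < t}) (hc : shortfallConj ν σ E x ≤ c) :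
    shortfallConj ν σ E x' ≤ ((c + (x' - x) * t : ℝ) : EReal) := by
  refine shortfallConj_le fun e he => EReal.coe_le_coe_iff.2 ?_
  rcases le_or_gt e t with het | hte
  · have hce := EReal.coe_le_coe_iff.1 ((le_shortfallConj he x).trans hc)
    have := mul_le_mul_of_nonneg_left het (sub_nonneg.2 hxx)
    linarith
  · have ht : (t : EReal) < E := (EReal.coe_lt_coe_iff.2 hte).trans he
    have hct := EReal.coe_le_coe_iff.1 ((le_shortfallConj ht x).trans hc)
    have hsub := hσ.shortfall_add_le ht he
    have := mul_le_mul_of_nonneg_left (htx ht) (sub_nonneg.2 hte.le)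
    linarith

end IntegrableBelow

end Slopes

section Rearrangement

variable {d : ℕ} {Ω : Set (EuclideanSpace ℝ (Fin d))} {f g q : EuclideanSpace ℝ (Fin d) → ℝ}
  {T : EuclideanSpace ℝ (Fin d) → ℝ≥0∞} {s : ℝ≥0∞}

lemma restrict_setOf (hΩ : NullMeasurableSet Ω volume) (p : EuclideanSpace ℝ (Fin d) → Prop) :
    volume.restrict Ω {x | p x} = volume {x | x ∈ Ω ∧ p x} := by
  rw [Measure.restrict_apply₀' hΩ, inter_comm]
  rfl

lemma distrib_eq (hΩ : NullMeasurableSet Ω volume) (t : ℝ) :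
    distrib Ω q t = volume.restrict Ω {x | t < q x} :=
  (restrict_setOf hΩ _).symm

lemma distrib_eq_neg_lt (hΩ : NullMeasurableSet Ω volume) (t : ℝ) :
    distrib Ω q t = volume.restrict Ω {x | -q x < -t} := by
  simp only [neg_lt_neg_iff, distrib_eq hΩ]

lemma jac_eq (hΩ : NullMeasurableSet Ω volume) (t : ℝ) :
    jac Ω q t = volume.restrict Ω {x | q x < t} :=
  (restrict_setOf hΩ _).symm

lemma beta_eq (hΩ : NullMeasurableSet Ω volume) (t : ℝ) :
    beta Ω f g t = volume.restrict Ω (g ⁻¹' Ioi t \ f ⁻¹' Ioi t) := by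
  rw [sdiff_eq, inter_comm, beta, ← restrict_setOf hΩ]
  simp only [← not_lt]
  rfl

lemma antitone_distrib : Antitone (distrib Ω q) :=
  fun _ _ hst => measure_mono fun _ hx => ⟨hx.1, lt_of_le_of_lt hst hx.2⟩

lemma monotone_jac : Monotone (jac Ω q) :=
  fun _ _ hst => measure_mono fun _ hx => ⟨hx.1, lt_of_lt_of_le hx.2 hst⟩

lemma jac_le (t : ℝ) : jac Ω q t ≤ volume Ω := measure_mono fun _ hx => hx.1

lemma distrib_le (t : ℝ) : distrib Ω q t ≤ volume Ω := measure_mono fun _ hx => hx.1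

lemma jac_lt_of_lt_eMax {t : ℝ} (ht : (t : EReal) < eMax Ω q) : jac Ω q t < volume Ω := by
  obtain ⟨_, ⟨u, hu, rfl⟩, htu⟩ := lt_sSup_iff.1 ht
  exact (monotone_jac (EReal.coe_lt_coe_iff.1 htu).le).trans_lt hu

lemma distrib_ne_top (hΩ : NullMeasurableSet Ω volume) (hq : NonnegL1 Ω q) {t : ℝ} (ht : 0 < t) :
    distrib Ω q t ≠ ⊤ := by
  rw [distrib_eq hΩ]
  exact (hq.1.measure_gt_lt_top ht).ne

lemma exists_gt_lt_distrib (hΩ : NullMeasurableSet Ω volume) {t : ℝ} (h : s < distrib Ω q t) :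
    ∃ t' > t, s < distrib Ω q t' := by
  by_contra! hle
  refine h.not_ge ?_
  rw [distrib_eq_neg_lt hΩ]
  refine measure_lt_le_of_forall fun u hu => ?_
  rw [← neg_neg u, ← distrib_eq_neg_lt hΩ]
  exact hle _ (lt_neg.1 hu)

lemma coe_lt_sharp (hΩ : NullMeasurableSet Ω volume) {t : ℝ≥0} :
    (t : ℝ≥0∞) < sharp Ω q s ↔ s < distrib Ω q t := by
  refine ⟨fun h => lt_of_not_ge fun hs => h.not_ge (sInf_le ⟨t, hs, rfl⟩), fun h => ?_⟩
  obtain ⟨t', htt', ht'⟩ := exists_gt_lt_distrib hΩ h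
  lift t' to ℝ≥0 using t.2.trans htt'.le
  refine lt_of_lt_of_le (b := (t' : ℝ≥0∞)) (by exact_mod_cast htt') (le_sInf ?_)
  rintro _ ⟨u, hu : distrib Ω q u ≤ s, rfl⟩
  by_contra! hut
  have hut : (u : ℝ) ≤ t' := by exact_mod_cast (ENNReal.coe_lt_coe.1 hut).le
  exact (ht'.trans_le (antitone_distrib hut)).not_ge hu

lemma antitone_sharp : Antitone (sharp Ω q) := fun _ _ hst =>
  sInf_le_sInf (image_mono fun _ (ht : _ ≤ _) => ht.trans hst)

lemma sharp_of_le (h : volume Ω ≤ s) : sharp Ω q s = 0 :=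
  nonpos_iff_eq_zero.1 (sInf_le ⟨0, (distrib_le _).trans h, rfl⟩)

lemma sharp_ne_top (hΩ : NullMeasurableSet Ω volume) (hq : NonnegL1 Ω q) (hs : s ≠ 0) :
    sharp Ω q s ≠ ⊤ := by
  have hfin := distrib_ne_top hΩ hq one_pos
  rw [distrib_eq_neg_lt hΩ] at hfin
  obtain ⟨t, ht⟩ := exists_measure_lt_lt hq.1.aemeasurable.neg hs hfin
  rw [← neg_neg t] at ht
  have ht : distrib Ω q (-t) < s := (distrib_eq_neg_lt hΩ (-t)).trans_lt ht
  have hle : distrib Ω q ((-t).toNNReal : ℝ) ≤ s :=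
    (antitone_distrib (Real.le_coe_toNNReal _)).trans ht.le
  exact ne_top_of_le_ne_top ENNReal.coe_ne_top (sInf_le ⟨_, hle, rfl⟩)

lemma lt_toReal_sharp_iff (hΩ : NullMeasurableSet Ω volume) (hq : NonnegL1 Ω q) (hs : s ≠ 0)
    {t : ℝ} (ht : 0 ≤ t) : t < (sharp Ω q s).toReal ↔ s < distrib Ω q t := by
  lift t to ℝ≥0 using ht
  rw [← coe_lt_sharp hΩ, ← ENNReal.toReal_lt_toReal ENNReal.coe_ne_top (sharp_ne_top hΩ hq hs),
    ENNReal.coe_toReal]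

lemma ae_lt_toReal_sharp_iff (hΩ : NullMeasurableSet Ω volume) (hq : NonnegL1 Ω q)
    (hT : IsRank T (volume.restrict Ω)) :
    ∀ᵐ x ∂volume.restrict Ω, ∀ t : ℝ, 0 ≤ t →
      (t < (sharp Ω q (T x)).toReal ↔ T x < distrib Ω q t) := by
  filter_upwards [hT.ae_pos] with x hx t ht
  exact lt_toReal_sharp_iff hΩ hq hx.ne' ht

lemma isRank_norm (hd : 1 ≤ d) (hΩ : NullMeasurableSet Ω volume) :
    IsRank (fun x => volume (Metric.ball (0 : EuclideanSpace ℝ (Fin d)) ‖x‖ ∩ Ω))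
      (volume.restrict Ω) := by
  have : Nonempty (Fin d) := ⟨⟨0, hd⟩⟩
  have hball : ∀ r : ℝ, {y : EuclideanSpace ℝ (Fin d) | ‖y‖ < r} = Metric.ball 0 r := fun r => by
    ext; simp
  simp_rw [← Measure.restrict_apply₀' hΩ, ← hball]
  refine isRank_measure_lt measurable_norm.aemeasurable fun m hm => ?_
  have hset : (univ : Set (EuclideanSpace ℝ (Fin d))) = ⋃ n : ℕ, {y | ‖y‖ < n} := by
    ext y
    simpa using exists_nat_gt ‖y‖
  have hmono : Monotone fun n : ℕ => {y : EuclideanSpace ℝ (Fin d) | ‖y‖ < n} :=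
    fun i j hij y (hy : ‖y‖ < i) => hy.trans_le (by exact_mod_cast hij)
  rw [hset, hmono.measure_iUnion, lt_iSup_iff] at hm
  obtain ⟨n, hn⟩ := hm
  refine ⟨n, hn, ?_, fun t _ => ?_⟩
  · rw [hball]
    exact ((Measure.restrict_apply_le _ _).trans_lt measure_ball_lt_top).ne
  · have hsphere : {x : EuclideanSpace ℝ (Fin d) | ‖x‖ = t} = Metric.sphere 0 t := by ext; simp
    rw [hsphere]
    exact Measure.absolutelyContinuous_of_le Measure.restrict_le_self
      (Measure.addHaar_sphere volume 0 t)

lemma beta_rearr (hd : 1 ≤ d) (hΩ : NullMeasurableSet Ω volume) (hf : NonnegL1 Ω f)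
    (hg : NonnegL1 Ω g) {s : ℝ} (hs : 0 ≤ s) :
    beta Ω (rearr Ω f) (rearr Ω g) s = distrib Ω g s - distrib Ω f s := by
  have hT := isRank_norm hd hΩ
  rw [← hT.measure_sdiff (a := distrib Ω f s) (b := distrib Ω g s), beta_eq hΩ]
  · refine measure_congr ?_
    filter_upwards [ae_lt_toReal_sharp_iff hΩ hf hT, ae_lt_toReal_sharp_iff hΩ hg hT] with x hf hg
    exact propext (and_congr (hg s hs) (not_congr (hf s hs)))
  all_goals rw [Measure.restrict_apply_univ]; exact distrib_le s

end Rearrangement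

namespace Admissible

variable {d : ℕ} {Ω : Set (EuclideanSpace ℝ (Fin d))} {σ q : EuclideanSpace ℝ (Fin d) → ℝ}
  {m : ℝ≥0∞} {e : ℝ}

lemma bot_lt_eMax (hσ : Admissible Ω σ) : ⊥ < eMax Ω σ := by
  obtain ⟨e, he⟩ := hσ.nonempty
  exact lt_of_lt_of_le (EReal.bot_lt_coe e) (le_sSup ⟨e, he, rfl⟩)

lemma exists_lt_jac (hσ : Admissible Ω σ) (hm : m < volume Ω) :
    ∃ e : ℝ, (e : EReal) < eMax Ω σ ∧ m < jac Ω σ e := by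
  have hne : (comap (fun e : ℝ => (e : EReal)) (𝓝[<] (eMax Ω σ))).NeBot := by
    refine comap_neBot_iff.2 fun t ht => ?_
    obtain ⟨l, hl, hlt⟩ := (mem_nhdsLT_iff_exists_Ioo_subset' hσ.bot_lt_eMax).1 ht
    exact (EReal.lt_iff_exists_real_btwn.1 hl).imp fun e he => hlt he
  have hlt : ∀ᶠ e : ℝ in comap (fun e : ℝ => (e : EReal)) (𝓝[<] (eMax Ω σ)),
      (e : EReal) < eMax Ω σ := tendsto_comap.eventually self_mem_nhdsWithin
  exact (hlt.and (hσ.tendsto_jac.eventually (lt_mem_nhds hm))).exists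

lemma jac_of_eMax_le (hσ : Admissible Ω σ) (he : eMax Ω σ ≤ e) : jac Ω σ e = volume Ω := by
  refine (jac_le e).antisymm (le_of_forall_lt fun m hm => ?_)
  obtain ⟨t, ht, hmt⟩ := hσ.exists_lt_jac hm
  exact hmt.trans_le (monotone_jac (EReal.coe_le_coe_iff.1 (ht.le.trans he)))

lemma exists_atomless_sublevel (hσ : Admissible Ω σ) (hm : m < volume Ω) :
    ∃ e : ℝ, (e : EReal) < eMax Ω σ ∧ m < volume.restrict Ω {x | σ x < e} ∧
      volume.restrict Ω {x | σ x < e} ≠ ⊤ ∧ ∀ t < e, volume.restrict Ω {x | σ x = t} = 0 := by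
  obtain ⟨e, he, hme⟩ := hσ.exists_lt_jac hm
  have hfin := (jac_lt_of_lt_eMax he).ne_top
  rw [jac_eq hσ.measurable_domain] at hme hfin
  refine ⟨e, he, hme, hfin, fun t ht => ?_⟩
  rw [restrict_setOf hσ.measurable_domain]
  exact hσ.level_null t ((EReal.coe_lt_coe_iff.2 ht).trans he)

lemma isRank_jac (hσ : Admissible Ω σ) :
    IsRank (fun x => jac Ω σ (σ x)) (volume.restrict Ω) := by
  simp only [jac_eq hσ.measurable_domain]
  refine isRank_measure_lt hσ.measurable_fun fun m hm => ?_
  rw [Measure.restrict_apply_univ] at hm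
  obtain ⟨e, -, h⟩ := hσ.exists_atomless_sublevel hm
  exact ⟨e, h⟩

lemma measure_jac_lt (hσ : Admissible Ω σ) (hm : m ≤ volume Ω) :
    volume.restrict Ω {x | jac Ω σ (σ x) < m} = m :=
  hσ.isRank_jac.measure_lt m (by rwa [Measure.restrict_apply_univ])

lemma exists_jac_eq (hσ : Admissible Ω σ) (hm0 : m ≠ 0) (hm : m < volume Ω) :
    ∃ c : ℝ, (c : EReal) < eMax Ω σ ∧ jac Ω σ c = m ∧
      {x | jac Ω σ (σ x) < m} =ᵐ[volume.restrict Ω] {x | σ x < c} := by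
  obtain ⟨e, he, hme, hfin, hlev⟩ := hσ.exists_atomless_sublevel hm
  obtain ⟨c, hce, hc, hae⟩ := exists_measure_lt_eq hσ.measurable_fun hm0 hme hfin hlev
  simp only [jac_eq hσ.measurable_domain]
  exact ⟨c, (EReal.coe_lt_coe_iff.2 hce).trans he, hc, hae⟩

lemma nullMeasurableSet_jac_lt (hσ : Admissible Ω σ) (m : ℝ≥0∞) :
    NullMeasurableSet {x | jac Ω σ (σ x) < m} (volume.restrict Ω) :=
  nullMeasurableSet_lt hσ.isRank_jac.aemeasurable aemeasurable_const

lemma sigmaRearr_eq (hσ : Admissible Ω σ) (q : EuclideanSpace ℝ (Fin d) → ℝ) :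
    sigmaRearr Ω σ q = fun x => (sharp Ω q (jac Ω σ (σ x))).toReal := by
  ext x
  rw [sigmaRearr]
  split_ifs with h
  · rfl
  · rw [hσ.jac_of_eMax_le (not_lt.1 h), sharp_of_le le_rfl, ENNReal.toReal_zero]

lemma sigmaRearr_nonneg (hσ : Admissible Ω σ) (q : EuclideanSpace ℝ (Fin d) → ℝ) :
    0 ≤ sigmaRearr Ω σ q := by
  rw [hσ.sigmaRearr_eq]
  exact fun _ => ENNReal.toReal_nonneg

lemma aemeasurable_sigmaRearr (hσ : Admissible Ω σ) (q : EuclideanSpace ℝ (Fin d) → ℝ) :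
    AEMeasurable (sigmaRearr Ω σ q) (volume.restrict Ω) := by
  rw [hσ.sigmaRearr_eq]
  exact (antitone_sharp.measurable.comp_aemeasurable hσ.isRank_jac.aemeasurable).ennreal_toReal

lemma ae_lt_sigmaRearr_iff (hσ : Admissible Ω σ) (hq : NonnegL1 Ω q) :
    ∀ᵐ x ∂volume.restrict Ω, ∀ t : ℝ, 0 ≤ t →
      (t < sigmaRearr Ω σ q x ↔ jac Ω σ (σ x) < distrib Ω q t) := by
  rw [hσ.sigmaRearr_eq]
  exact ae_lt_toReal_sharp_iff hσ.measurable_domain hq hσ.isRank_jac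

lemma setOf_lt_sigmaRearr_ae_eq (hσ : Admissible Ω σ) (hq : NonnegL1 Ω q) {t : ℝ} (ht : 0 ≤ t) :
    {x | t < sigmaRearr Ω σ q x} =ᵐ[volume.restrict Ω] {x | jac Ω σ (σ x) < distrib Ω q t} := by
  filter_upwards [hσ.ae_lt_sigmaRearr_iff hq] with x hx
  exact propext (hx t ht)

lemma distrib_sigmaRearr (hσ : Admissible Ω σ) (hq : NonnegL1 Ω q) {t : ℝ} (ht : 0 ≤ t) :
    distrib Ω (sigmaRearr Ω σ q) t = distrib Ω q t := by
  rw [distrib_eq hσ.measurable_domain, measure_congr (hσ.setOf_lt_sigmaRearr_ae_eq hq ht),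
    hσ.measure_jac_lt (distrib_le t)]

lemma ae_lt_eMax (hσ : Admissible Ω σ) (hV : volume Ω ≠ ⊤) :
    ∀ᵐ x ∂volume.restrict Ω, (σ x : EReal) < eMax Ω σ := by
  have hset : {x | jac Ω σ (σ x) < volume Ω} =ᵐ[volume.restrict Ω] univ := by
    have hfin : volume.restrict Ω univ ≠ ⊤ := by rwa [Measure.restrict_apply_univ]
    refine ae_eq_of_subset_of_measure_ge (subset_univ _) ?_ (hσ.nullMeasurableSet_jac_lt _) hfin
    rw [hσ.measure_jac_lt le_rfl, Measure.restrict_apply_univ]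
  filter_upwards [eventuallyEq_univ.1 hset] with x hx
  exact lt_of_not_ge fun h => (lt_of_lt_of_eq hx (hσ.jac_of_eMax_le h).symm).false

lemma integrableOn_jac_lt (hσ : Admissible Ω σ)
    (hB : ∀ μ : ℝ≥0∞, μ < volume Ω → IntegrableOn σ (sublevel Ω σ μ) volume)
    (hm : m < volume Ω) : IntegrableOn σ {x | jac Ω σ (σ x) < m} (volume.restrict Ω) := by
  rw [IntegrableOn, Measure.restrict_restrict₀ (hσ.nullMeasurableSet_jac_lt m), inter_comm]
  exact hB m hm

lemma integrableBelow (hσ : Admissible Ω σ)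
    (hB : ∀ μ : ℝ≥0∞, μ < volume Ω → IntegrableOn σ (sublevel Ω σ μ) volume) :
    IntegrableBelow (volume.restrict Ω) σ (eMax Ω σ) := by
  refine ⟨hσ.measurable_fun, hσ.bot_lt_eMax, fun e he => ?_⟩
  obtain ⟨m, hem, hm⟩ := exists_between (jac_lt_of_lt_eMax he)
  set A := {x | jac Ω σ (σ x) < m}
  have hA : volume.restrict Ω A ≠ ⊤ := by rw [hσ.measure_jac_lt hm.le]; exact hm.ne_top
  have hi : IntegrableOn (fun x => max (e - σ x) 0) A (volume.restrict Ω) :=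
    ((integrableOn_const hA).sub (hσ.integrableOn_jac_lt hB hm)).pos_part
  refine (integrableOn_iff_integrable_of_support_subset fun x hx => ?_).1 hi
  have hxe : σ x < e := lt_of_not_ge fun h => hx (max_eq_right (sub_nonpos.2 h))
  exact (monotone_jac hxe.le).trans_lt hem

end Admissible

section Energy

variable {d : ℕ} {Ω : Set (EuclideanSpace ℝ (Fin d))} {σ : EuclideanSpace ℝ (Fin d) → ℝ}
  {m n b : ℝ≥0∞} {c : ℝ}

namespace Admissible

lemma shortfallConj_eq_setIntegral_of_lt (hσ : Admissible Ω σ)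
    (hI : IntegrableBelow (volume.restrict Ω) σ (eMax Ω σ)) (hm : m < volume Ω) :
    IntegrableOn σ {x | jac Ω σ (σ x) < m} (volume.restrict Ω) ∧
      shortfallConj (volume.restrict Ω) σ (eMax Ω σ) m.toReal =
        ((∫ x in {x | jac Ω σ (σ x) < m}, σ x ∂volume.restrict Ω : ℝ) : EReal) := by
  rcases eq_or_ne m 0 with rfl | hm0
  · simp only [not_lt_zero, ofPred_false, integrableOn_empty, ENNReal.toReal_zero,
      hI.shortfallConj_zero, setIntegral_empty, EReal.coe_zero, and_self]
  · obtain ⟨c, hc, rfl, hae⟩ := hσ.exists_jac_eq hm0 hm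
    rw [integrableOn_congr_set_ae hae, setIntegral_congr_set hae, ← hI.shortfallConj_measure_lt hc,
      jac_eq hσ.measurable_domain, measureReal_def]
    exact ⟨hI.integrableOn_lt hc, rfl⟩

lemma coe_bigB (hσ : Admissible Ω σ) (hI : IntegrableBelow (volume.restrict Ω) σ (eMax Ω σ))
    (hm : m < volume Ω) :
    (bigB Ω σ m : EReal) = shortfallConj (volume.restrict Ω) σ (eMax Ω σ) m.toReal := by
  rw [(hσ.shortfallConj_eq_setIntegral_of_lt hI hm).2,
    Measure.restrict_restrict₀ (hσ.nullMeasurableSet_jac_lt m), inter_comm]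
  rfl

lemma bigBExt_eq (hσ : Admissible Ω σ) (hI : IntegrableBelow (volume.restrict Ω) σ (eMax Ω σ))
    (hm : m ≠ ⊤) :
    bigBExt Ω σ m = shortfallConj (volume.restrict Ω) σ (eMax Ω σ) m.toReal := by
  rcases lt_or_ge m (volume Ω) with hmV | hVm
  · rw [bigBExt, if_pos hmV, hσ.coe_bigB hI hmV]
  have hV : volume Ω ≠ ⊤ := ne_top_of_le_ne_top hm hVm
  have : IsFiniteMeasure (volume.restrict Ω) := isFiniteMeasure_restrict.2 hV
  have hy : m.toReal = (volume.restrict Ω).real univ + (m - volume Ω).toReal := by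
    rw [measureReal_restrict_apply_univ, measureReal_def,
      ← ENNReal.toReal_add hV (ENNReal.sub_ne_top hm), add_tsub_cancel_of_le hVm]
  rw [bigBExt, if_neg hVm.not_gt, hy,
    hI.shortfallConj_univ_add (hσ.ae_lt_eMax hV) ENNReal.toReal_nonneg,
    EReal.coe_ennreal_toReal (ENNReal.sub_ne_top hm)]

lemma shortfallConj_eq_setIntegral (hσ : Admissible Ω σ)
    (hI : IntegrableBelow (volume.restrict Ω) σ (eMax Ω σ)) (hm : m ≤ volume Ω) (hmt : m ≠ ⊤)
    (hfin : shortfallConj (volume.restrict Ω) σ (eMax Ω σ) m.toReal ≠ ⊤) :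
    IntegrableOn σ {x | jac Ω σ (σ x) < m} (volume.restrict Ω) ∧
      shortfallConj (volume.restrict Ω) σ (eMax Ω σ) m.toReal =
        ((∫ x in {x | jac Ω σ (σ x) < m}, σ x ∂volume.restrict Ω : ℝ) : EReal) := by
  rcases hm.lt_or_eq with hmV | rfl
  · exact hσ.shortfallConj_eq_setIntegral_of_lt hI hmV
  have : IsFiniteMeasure (volume.restrict Ω) := isFiniteMeasure_restrict.2 hmt
  have hae : {x | jac Ω σ (σ x) < volume Ω} =ᵐ[volume.restrict Ω] univ := by
    filter_upwards [hσ.ae_lt_eMax hmt] with x hx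
    exact eq_true (jac_lt_of_lt_eMax hx)
  have hext := hσ.bigBExt_eq hI hmt
  rw [bigBExt, if_neg (lt_irrefl _), tsub_self, EReal.coe_ennreal_zero, mul_zero, add_zero] at hext
  rw [← hext] at hfin
  have hneg := hI.lintegral_neg_ne_top (measure_ne_top _ univ)
  rw [setLIntegral_univ] at hneg
  have hi := integrable_of_extIntegral_ne_top hσ.measurable_fun hneg hfin
  refine ⟨hi.integrableOn, ?_⟩
  rw [← hext, extIntegral_coe hi, setIntegral_congr_set hae, setIntegral_univ]

lemma convexOn_bigB (hσ : Admissible Ω σ)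
    (hI : IntegrableBelow (volume.restrict Ω) σ (eMax Ω σ)) :
    ConvexOn ℝ {m : ℝ | 0 ≤ m ∧ ENNReal.ofReal m < volume Ω}
      (fun m => bigB Ω σ (ENNReal.ofReal m)) := by
  have hconv : Convex ℝ {m : ℝ | 0 ≤ m ∧ ENNReal.ofReal m < volume Ω} :=
    OrdConnected.convex ⟨fun x hx y hy z hz =>
      ⟨hx.1.trans hz.1, (ENNReal.ofReal_le_ofReal hz.2).trans_lt hy.2⟩⟩
  have hcoe : ∀ x : ℝ, 0 ≤ x ∧ ENNReal.ofReal x < volume Ω →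
      (bigB Ω σ (ENNReal.ofReal x) : EReal) =
        shortfallConj (volume.restrict Ω) σ (eMax Ω σ) x := fun x hx => by
    rw [hσ.coe_bigB hI hx.2, ENNReal.toReal_ofReal hx.1]
  refine ⟨hconv, fun x hx y hy a b ha hb hab => ?_⟩
  rw [← EReal.coe_le_coe_iff, hcoe _ (hconv hx hy ha hb hab)]
  exact shortfallConj_convex (hcoe x hx).ge (hcoe y hy).ge ha hb hab

lemma secondDiff_eq (hσ : Admissible Ω σ)
    (hI : IntegrableBelow (volume.restrict Ω) σ (eMax Ω σ)) (hm : m ≠ ⊤) (hb : b ≤ m) :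
    secondDiff Ω σ m b = shortfallConj (volume.restrict Ω) σ (eMax Ω σ) (m.toReal + b.toReal) +
      shortfallConj (volume.restrict Ω) σ (eMax Ω σ) (m.toReal - b.toReal) -
      2 * shortfallConj (volume.restrict Ω) σ (eMax Ω σ) m.toReal := by
  have hbt : b ≠ ⊤ := ne_top_of_le_ne_top hm hb
  rw [secondDiff, hσ.bigBExt_eq hI (ENNReal.add_ne_top.2 ⟨hm, hbt⟩),
    hσ.bigBExt_eq hI (ENNReal.sub_ne_top hm), hσ.bigBExt_eq hI hm,
    ENNReal.toReal_add hm hbt, ENNReal.toReal_sub_of_le hb hm]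

end Admissible

lemma lt_jac_of_jacInv_lt {t : ℝ} (h : jacInv Ω σ m < t) (ht : (t : EReal) < eMax Ω σ) :
    m < jac Ω σ t := by
  by_contra! hle
  exact h.not_ge (le_sSup ⟨t, ⟨ht, hle⟩, rfl⟩)

lemma exists_of_lt_jacInv {t : ℝ} (h : (t : EReal) < jacInv Ω σ m) :
    ∃ t' : ℝ, t < t' ∧ (t' : EReal) < eMax Ω σ ∧ jac Ω σ t' ≤ m := by
  obtain ⟨_, ⟨t', ht', rfl⟩, htt⟩ := lt_sSup_iff.1 h
  exact ⟨t', EReal.coe_lt_coe_iff.1 htt, ht'⟩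

namespace Admissible

lemma shortfallConj_le_add_jacInv (hσ : Admissible Ω σ)
    (hI : IntegrableBelow (volume.restrict Ω) σ (eMax Ω σ)) (hm : m ≠ ⊤) (hb : b ≤ m)
    (hnm : n < m)
    (hc : shortfallConj (volume.restrict Ω) σ (eMax Ω σ) (n.toReal + b.toReal) ≤ c) :
    shortfallConj (volume.restrict Ω) σ (eMax Ω σ) (m.toReal + b.toReal) ≤
      c + ((m - n : ℝ≥0∞) : EReal) * jacInv Ω σ (2 * m) := by
  have hnm' : n.toReal < m.toReal := (ENNReal.toReal_lt_toReal hnm.ne_top hm).2 hnm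
  rw [← EReal.coe_ennreal_toReal (ENNReal.sub_ne_top hm), ENNReal.toReal_sub_of_le hnm.le hm]
  refine le_coe_add_mul_of_forall_gt (sub_pos.2 hnm') fun t ht => ?_
  rw [← add_sub_add_right_eq_sub _ _ b.toReal]
  refine hI.shortfallConj_le_add (by linarith) (fun htE => ?_) hc
  rw [measureReal_def, ← jac_eq hσ.measurable_domain,
    ← ENNReal.toReal_add hm (ne_top_of_le_ne_top hm hb)]
  refine ENNReal.toReal_mono (jac_lt_of_lt_eMax htE).ne_top ?_
  calc m + b ≤ 2 * m := by rw [two_mul]; gcongr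
    _ ≤ jac Ω σ t := (lt_jac_of_jacInv_lt ht htE).le

lemma shortfallConj_le_sub_jacInv (hσ : Admissible Ω σ)
    (hI : IntegrableBelow (volume.restrict Ω) σ (eMax Ω σ)) (hn : n ≠ ⊤) (hmn : m < n)
    (hc : shortfallConj (volume.restrict Ω) σ (eMax Ω σ) (n.toReal + b.toReal) ≤ c) :
    shortfallConj (volume.restrict Ω) σ (eMax Ω σ) (m.toReal + b.toReal) ≤
      c - ((n - m : ℝ≥0∞) : EReal) * jacInv Ω σ m := by
  have hmn' : m.toReal < n.toReal := (ENNReal.toReal_lt_toReal hmn.ne_top hn).2 hmn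
  rw [← EReal.coe_ennreal_toReal (ENNReal.sub_ne_top hn), ENNReal.toReal_sub_of_le hmn.le hn]
  refine le_coe_sub_mul_of_forall_lt (sub_pos.2 hmn') fun t ht => ?_
  obtain ⟨t', htt', htE, hjac⟩ := exists_of_lt_jacInv ht
  have hjac : (volume.restrict Ω).real {x | σ x < t'} ≤ m.toReal + b.toReal := by
    rw [measureReal_def, ← jac_eq hσ.measurable_domain]
    exact (ENNReal.toReal_mono hmn.ne_top hjac).trans (le_add_of_nonneg_right b.toReal_nonneg)
  refine (hI.shortfallConj_le_sub (by linarith) htE hjac hc).trans (EReal.coe_le_coe_iff.2 ?_)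
  rw [add_sub_add_right_eq_sub]
  gcongr

/-- `b_σ(m)` and `b_σ(2m)` bound the slopes of `B_σ` on the two sides of `m + b`. -/
lemma shortfallConj_le_of_slopes (hσ : Admissible Ω σ)
    (hI : IntegrableBelow (volume.restrict Ω) σ (eMax Ω σ)) (hm : m ≠ ⊤) (hn : n ≠ ⊤) (hb : b ≤ m)
    (hc : shortfallConj (volume.restrict Ω) σ (eMax Ω σ) (n.toReal + b.toReal) ≤ c) :
    shortfallConj (volume.restrict Ω) σ (eMax Ω σ) (m.toReal + b.toReal) ≤
      c + (((m - n : ℝ≥0∞) : EReal) * jacInv Ω σ (2 * m) -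
        ((n - m : ℝ≥0∞) : EReal) * jacInv Ω σ m) := by
  rcases lt_trichotomy n m with hnm | rfl | hmn
  · rw [tsub_eq_zero_of_le hnm.le, EReal.coe_ennreal_zero, zero_mul, sub_zero]
    exact hσ.shortfallConj_le_add_jacInv hI hm hb hnm hc
  · rwa [tsub_self, EReal.coe_ennreal_zero, zero_mul, zero_mul, sub_zero, add_zero]
  · rw [tsub_eq_zero_of_le hmn.le, EReal.coe_ennreal_zero, zero_mul, zero_sub, ← sub_eq_add_neg]
    exact hσ.shortfallConj_le_sub_jacInv hI hn hmn hc

end Admissible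

end Energy

section ERealArithmetic

lemma coe_toENNReal_sub_coe_toENNReal_neg (c : EReal) :
    (c.toENNReal : EReal) - ((-c).toENNReal : EReal) = c := by
  rcases le_total 0 c with h | h
  · rw [EReal.coe_toENNReal h, EReal.toENNReal_of_nonpos (EReal.neg_le_zero.2 h),
      EReal.coe_ennreal_zero, sub_zero]
  · rw [EReal.toENNReal_of_nonpos h, EReal.coe_toENNReal (EReal.neg_nonneg.2 h),
      EReal.coe_ennreal_zero, zero_sub, neg_neg]

lemma coe_le_sub_add_sub_iff {p n r u v : ℝ≥0∞} (hp : p ≠ ⊤) (hu : u ≠ ⊤) :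
    (r : EReal) ≤ (p - n) + (u - v) ↔ n + (r + v) ≤ p + u := by
  rcases eq_or_ne n ⊤ with rfl | hn
  · simp [EReal.sub_top, hp, hu]
  rcases eq_or_ne v ⊤ with rfl | hv
  · simp [EReal.sub_top, hp, hu]
  rw [← EReal.coe_ennreal_toReal hp, ← EReal.coe_ennreal_toReal hu, ← EReal.coe_ennreal_toReal hn,
    ← EReal.coe_ennreal_toReal hv, ← EReal.coe_sub, ← EReal.coe_sub, ← EReal.coe_add]
  rcases eq_or_ne r ⊤ with rfl | hr
  · simp [hp, hu, -EReal.coe_add, -EReal.coe_sub]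
  rw [← EReal.coe_ennreal_toReal hr, EReal.coe_le_coe_iff, ← ENNReal.toReal_le_toReal
    (by finiteness) (by finiteness), ENNReal.toReal_add hn (by finiteness),
    ENNReal.toReal_add hr hv, ENNReal.toReal_add hp hu]
  constructor <;> intro h <;> linarith

lemma coe_add_add_coe_sub_sub_two_mul (a x y : ℝ) (r : EReal) :
    ((a + x : ℝ) : EReal) + r + ((a - y : ℝ) : EReal) - 2 * (a : EReal) =
      ((x - y : ℝ) : EReal) + r := by
  have h2 : (2 : EReal) * a = ((2 * a : ℝ) : EReal) := rfl
  rw [h2]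
  induction r with
  | bot => simp only [EReal.add_bot, EReal.bot_add, EReal.bot_sub]
  | top => rw [EReal.coe_add_top, EReal.coe_add_top, EReal.top_add_coe, EReal.top_sub_coe]
  | coe r =>
    norm_cast
    ring

end ERealArithmetic

section LevelSets

variable {α : Type*} [MeasurableSpace α] {ν : Measure α} {σ : α → ℝ} {E : EReal} {G P : Set α}

lemma coe_setIntegral_sub_setIntegral (hG : IntegrableOn σ G ν) (hP : IntegrableOn σ P ν) :
    ((∫ x in P, σ x ∂ν - ∫ x in G, σ x ∂ν : ℝ) : EReal) =
      ((∫⁻ x in P, ENNReal.ofReal (σ x) ∂ν + ∫⁻ x in G, ENNReal.ofReal (-σ x) ∂ν : ℝ≥0∞) : EReal) -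
      ((∫⁻ x in P, ENNReal.ofReal (-σ x) ∂ν + ∫⁻ x in G, ENNReal.ofReal (σ x) ∂ν : ℝ≥0∞) :
        EReal) := by
  have hG1 := (Integrable.lintegral_lt_top hG).ne
  have hG2 := (Integrable.lintegral_lt_top hG.neg).ne
  have hP1 := (Integrable.lintegral_lt_top hP).ne
  have hP2 := (Integrable.lintegral_lt_top hP.neg).ne
  simp only [Pi.neg_apply] at hG2 hP2
  rw [← EReal.coe_ennreal_toReal (ENNReal.add_ne_top.2 ⟨hP1, hG2⟩),
    ← EReal.coe_ennreal_toReal (ENNReal.add_ne_top.2 ⟨hP2, hG1⟩), ← EReal.coe_sub,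
    ENNReal.toReal_add hP1 hG2, ENNReal.toReal_add hP2 hG1,
    integral_eq_lintegral_pos_part_sub_lintegral_neg_part hP,
    integral_eq_lintegral_pos_part_sub_lintegral_neg_part hG]
  ring_nf

namespace IntegrableBelow

lemma shortfallConj_le_setIntegral_sub (hI : IntegrableBelow ν σ E) (hP : NullMeasurableSet P ν)
    (hG : ν G ≠ ⊤) (hi : IntegrableOn σ G ν) :
    shortfallConj ν σ E (ν.real G - ν.real (G \ P)) ≤
      ((∫ x in G, σ x ∂ν - ∫ x in G \ P, σ x ∂ν : ℝ) : EReal) := by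
  rw [← measureReal_inter_add_sdiff₀ hP hG, ← integral_inter_add_sdiff₀ hP hi,
    add_sub_cancel_right, add_sub_cancel_right]
  exact hI.shortfallConj_le_setIntegral
    (ne_top_of_le_ne_top hG (measure_mono inter_subset_left)) (hi.mono_set inter_subset_left)

lemma shortfallConj_le_setIntegral_add (hI : IntegrableBelow ν σ E) (hG : NullMeasurableSet G ν)
    (hP : NullMeasurableSet P ν) (hGt : ν G ≠ ⊤) (hPt : ν P ≠ ⊤) (hiG : IntegrableOn σ G ν)
    (hi : IntegrableOn σ (P \ G) ν) :
    shortfallConj ν σ E (ν.real P + ν.real (G \ P)) ≤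
      ((∫ x in G, σ x ∂ν + ∫ x in P \ G, σ x ∂ν : ℝ) : EReal) := by
  have hUt : ν (G ∪ P) ≠ ⊤ := (measure_union_lt_top hGt.lt_top hPt.lt_top).ne
  have hiU : IntegrableOn σ (G ∪ P) ν := by
    rw [← union_sdiff_self]
    exact hiG.union hi
  have hint := integral_inter_add_sdiff₀ hG hiU
  have hmeas := measureReal_inter_add_sdiff₀ (s := G ∪ P) hP hUt
  rw [union_inter_cancel_left, union_sdiff_left] at hint
  rw [union_inter_cancel_right, union_sdiff_right] at hmeas
  rw [hint, hmeas]
  exact hI.shortfallConj_le_setIntegral hUt hiU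

end IntegrableBelow

end LevelSets

section LevelInequality

variable {d : ℕ} {Ω : Set (EuclideanSpace ℝ (Fin d))} {σ f q : EuclideanSpace ℝ (Fin d) → ℝ}
  {m b : ℝ≥0∞} {s : ℝ}

namespace Admissible

lemma secondDiff_nonneg (hσ : Admissible Ω σ)
    (hI : IntegrableBelow (volume.restrict Ω) σ (eMax Ω σ)) (hm : m ≠ ⊤) (hb : b ≤ m)
    (hfin : shortfallConj (volume.restrict Ω) σ (eMax Ω σ) m.toReal ≠ ⊤) :
    0 ≤ secondDiff Ω σ m b := by
  rw [hσ.secondDiff_eq hI hm hb]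
  have h2 : (2 : EReal) = ((2 : ℝ) : EReal) := rfl
  have hlb := hI.bot_lt_shortfallConj
  lift shortfallConj (volume.restrict Ω) σ (eMax Ω σ) m.toReal to ℝ using ⟨hfin, (hlb _).ne'⟩
    with c hc
  rw [h2, ← EReal.coe_mul]
  rcases eq_or_ne (shortfallConj (volume.restrict Ω) σ (eMax Ω σ) (m.toReal + b.toReal)) ⊤
    with hx | hx
  · rw [hx, EReal.top_add_of_ne_bot (hlb _).ne', EReal.top_sub_coe]
    exact le_top
  rcases eq_or_ne (shortfallConj (volume.restrict Ω) σ (eMax Ω σ) (m.toReal - b.toReal)) ⊤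
    with hy | hy
  · rw [hy, EReal.add_top_of_ne_bot (hlb _).ne', EReal.top_sub_coe]
    exact le_top
  have hmid := shortfallConj_convex (EReal.coe_toReal hx (hlb _).ne').ge
    (EReal.coe_toReal hy (hlb _).ne').ge one_half_pos.le one_half_pos.le (add_halves (1 : ℝ))
  rw [show 1 / 2 * (m.toReal + b.toReal) + 1 / 2 * (m.toReal - b.toReal) = m.toReal by ring, ← hc,
    EReal.coe_le_coe_iff] at hmid
  rw [← EReal.coe_toReal hx (hlb _).ne', ← EReal.coe_toReal hy (hlb _).ne', ← EReal.coe_add,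
    ← EReal.coe_sub]
  exact EReal.coe_nonneg.2 (by linarith)

lemma beta_le_distrib (hσ : Admissible Ω σ) (hq : NonnegL1 Ω q)
    (f : EuclideanSpace ℝ (Fin d) → ℝ) (hs : 0 ≤ s) :
    beta Ω f (sigmaRearr Ω σ q) s ≤ distrib Ω q s := by
  rw [← hσ.distrib_sigmaRearr hq hs]
  exact measure_mono fun x hx => ⟨hx.1, hx.2.2⟩

/-- Tests `B_σ` with the union and with the intersection of the superlevel sets of `f` and
`q^{*σ}`. -/
lemma secondDiff_le (hd : 1 ≤ d) (hσ : Admissible Ω σ)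
    (hI : IntegrableBelow (volume.restrict Ω) σ (eMax Ω σ)) (hf : NonnegL1 Ω f) (hq : NonnegL1 Ω q)
    (hs : 0 < s) (hi : IntegrableOn σ (sigmaRearr Ω σ q ⁻¹' Ioi s) (volume.restrict Ω))
    (hB : shortfallConj (volume.restrict Ω) σ (eMax Ω σ) (distrib Ω q s).toReal =
      ((∫ x in sigmaRearr Ω σ q ⁻¹' Ioi s, σ x ∂volume.restrict Ω : ℝ) : EReal))
    (hif : IntegrableOn σ (f ⁻¹' Ioi s \ sigmaRearr Ω σ q ⁻¹' Ioi s) (volume.restrict Ω)) :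
    secondDiff Ω σ (distrib Ω q s) (beta Ω f (sigmaRearr Ω σ q) s) ≤
      ((∫ x in f ⁻¹' Ioi s \ sigmaRearr Ω σ q ⁻¹' Ioi s, σ x ∂volume.restrict Ω -
        ∫ x in sigmaRearr Ω σ q ⁻¹' Ioi s \ f ⁻¹' Ioi s, σ x ∂volume.restrict Ω : ℝ) : EReal) +
        correction Ω σ f q s := by
  have hΩ := hσ.measurable_domain
  have hm := distrib_ne_top hΩ hq hs
  have hn := distrib_ne_top hΩ hf hs
  have hbm := hσ.beta_le_distrib hq f hs.le
  have hG : NullMeasurableSet (sigmaRearr Ω σ q ⁻¹' Ioi s) (volume.restrict Ω) :=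
    (hσ.aemeasurable_sigmaRearr q).nullMeasurableSet_preimage measurableSet_Ioi
  have hP : NullMeasurableSet (f ⁻¹' Ioi s) (volume.restrict Ω) :=
    hf.1.aemeasurable.nullMeasurableSet_preimage measurableSet_Ioi
  have hνG : volume.restrict Ω (sigmaRearr Ω σ q ⁻¹' Ioi s) = distrib Ω q s := by
    rw [← hσ.distrib_sigmaRearr hq hs.le, distrib_eq hΩ]
    rfl
  have hνP : volume.restrict Ω (f ⁻¹' Ioi s) = distrib Ω f s := (distrib_eq hΩ s).symm
  have hinter := hI.shortfallConj_le_setIntegral_sub hP (hνG ▸ hm) hi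
  have hunion := hI.shortfallConj_le_setIntegral_add hG hP (hνG ▸ hm) (hνP ▸ hn) hi hif
  rw [measureReal_def, measureReal_def, ← beta_eq hΩ] at hinter hunion
  rw [hνG] at hinter
  rw [hνP] at hunion
  have hslope := hσ.shortfallConj_le_of_slopes hI hm hn hbm hunion
  rw [← beta_rearr hd hΩ hf hq hs.le, ← beta_rearr hd hΩ hq hf hs.le, ← correction] at hslope
  rw [hσ.secondDiff_eq hI hm hbm, hB]
  exact (EReal.sub_le_sub (add_le_add hslope hinter) le_rfl).trans_eq
    (coe_add_add_coe_sub_sub_two_mul _ _ _ _)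

/-- Positive and negative parts are moved to opposite sides, so that no `∞ - ∞` occurs. -/
lemma level_inequality (hd : 1 ≤ d) (hσ : Admissible Ω σ)
    (hI : IntegrableBelow (volume.restrict Ω) σ (eMax Ω σ)) (hf : NonnegL1 Ω f) (hq : NonnegL1 Ω q)
    (hs : 0 < s) (hfin : bigBExt Ω σ (distrib Ω q s) ≠ ⊤) :
    ((∫⁻ x in f ⁻¹' Ioi s \ sigmaRearr Ω σ q ⁻¹' Ioi s, ENNReal.ofReal (-σ x)
          ∂volume.restrict Ω) +
        ∫⁻ x in sigmaRearr Ω σ q ⁻¹' Ioi s \ f ⁻¹' Ioi s, ENNReal.ofReal (σ x)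
          ∂volume.restrict Ω) +
      ((secondDiff Ω σ (distrib Ω q s) (beta Ω f (sigmaRearr Ω σ q) s)).toENNReal +
        (-correction Ω σ f q s).toENNReal) ≤
    ((∫⁻ x in f ⁻¹' Ioi s \ sigmaRearr Ω σ q ⁻¹' Ioi s, ENNReal.ofReal (σ x)
          ∂volume.restrict Ω) +
        ∫⁻ x in sigmaRearr Ω σ q ⁻¹' Ioi s \ f ⁻¹' Ioi s, ENNReal.ofReal (-σ x)
          ∂volume.restrict Ω) +
      (correction Ω σ f q s).toENNReal := by
  have hΩ := hσ.measurable_domain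
  have hm := distrib_ne_top hΩ hq hs
  rw [hσ.bigBExt_eq hI hm] at hfin
  rcases eq_or_ne (∫⁻ x in f ⁻¹' Ioi s \ sigmaRearr Ω σ q ⁻¹' Ioi s, ENNReal.ofReal (σ x)
    ∂volume.restrict Ω) ⊤ with hpos | hpos
  · rw [hpos, top_add, top_add]
    exact le_top
  rcases eq_or_ne (correction Ω σ f q s) ⊤ with hc | hc
  · rw [hc, EReal.toENNReal_top, add_top]
    exact le_top
  obtain ⟨hi, hB⟩ := hσ.shortfallConj_eq_setIntegral hI (distrib_le s) hm hfin
  have hae := hσ.setOf_lt_sigmaRearr_ae_eq hq hs.le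
  rw [← setIntegral_congr_set hae] at hB
  replace hi : IntegrableOn σ (sigmaRearr Ω σ q ⁻¹' Ioi s) (volume.restrict Ω) :=
    hi.congr_set_ae hae
  have hif : IntegrableOn σ (f ⁻¹' Ioi s \ sigmaRearr Ω σ q ⁻¹' Ioi s) (volume.restrict Ω) := by
    refine integrable_of_lintegral_ofReal_ne_top hσ.measurable_fun.restrict hpos
      (hI.lintegral_neg_ne_top (ne_top_of_le_ne_top ?_ (measure_mono sdiff_subset)))
    exact (distrib_eq hΩ s).symm.trans_ne (distrib_ne_top hΩ hf hs)
  have hig := hi.mono_set (sdiff_subset (t := f ⁻¹' Ioi s))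
  have hle := hσ.secondDiff_le hd hI hf hq hs hi hB hif
  rw [coe_setIntegral_sub_setIntegral hig hif, ← EReal.coe_toENNReal
    (hσ.secondDiff_nonneg hI hm (hσ.beta_le_distrib hq f hs.le) hfin),
    ← coe_toENNReal_sub_coe_toENNReal_neg (correction Ω σ f q s)] at hle
  refine (coe_le_sub_add_sub_iff (ENNReal.add_ne_top.2 ⟨hpos, ?_⟩)
    (EReal.toENNReal_ne_top_iff.2 hc)).1 hle
  exact (Integrable.lintegral_lt_top hig.neg).ne

end Admissible

end LevelInequality

section LayerCake

variable {α : Type*} [MeasurableSpace α] {ν : Measure α} {f g σ : α → ℝ} {w : α → ℝ≥0∞}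

lemma nullMeasurableSet_preimage_Ioi_sdiff (hf : AEMeasurable f ν) (hg : AEMeasurable g ν)
    (s : ℝ) : NullMeasurableSet (f ⁻¹' Ioi s \ g ⁻¹' Ioi s) ν :=
  (hf.nullMeasurableSet_preimage measurableSet_Ioi).diff
    (hg.nullMeasurableSet_preimage measurableSet_Ioi)

lemma aemeasurable_indicator_preimage_Ioi_sdiff (hf : AEMeasurable f ν) (hg : AEMeasurable g ν)
    (hw : AEMeasurable w ν) :
    AEMeasurable (fun p : ℝ × α => (f ⁻¹' Ioi p.1 \ g ⁻¹' Ioi p.1).indicator w p.2)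
      ((volume.restrict (Ioi (0 : ℝ))).prod ν) := by
  have hsnd : Measure.QuasiMeasurePreserving (Prod.snd : ℝ × α → α)
    ((volume.restrict (Ioi (0 : ℝ))).prod ν) ν := Measure.quasiMeasurePreserving_snd
  have hlt : ∀ {u : α → ℝ}, AEMeasurable u ν → NullMeasurableSet {p : ℝ × α | p.1 < u p.2}
      ((volume.restrict (Ioi (0 : ℝ))).prod ν) := fun hu =>
    nullMeasurableSet_lt measurable_fst.aemeasurable (hu.comp_quasiMeasurePreserving hsnd)
  exact (hw.comp_quasiMeasurePreserving hsnd).indicator₀ ((hlt hf).diff (hlt hg))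

lemma aemeasurable_lintegral_preimage_Ioi_sdiff [SFinite ν] (hf : AEMeasurable f ν)
    (hg : AEMeasurable g ν) (hw : AEMeasurable w ν) :
    AEMeasurable (fun s : ℝ => ∫⁻ x in f ⁻¹' Ioi s \ g ⁻¹' Ioi s, w x ∂ν)
      (volume.restrict (Ioi (0 : ℝ))) := by
  simp_rw [← lintegral_indicator₀ (nullMeasurableSet_preimage_Ioi_sdiff hf hg _)]
  exact (aemeasurable_indicator_preimage_Ioi_sdiff hf hg hw).lintegral_prod_right'

lemma lintegral_lintegral_preimage_Ioi_sdiff [SFinite ν] (hf : AEMeasurable f ν)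
    (hg : AEMeasurable g ν) (hw : AEMeasurable w ν) (hg0 : 0 ≤ᵐ[ν] g) :
    ∫⁻ s in Ioi (0 : ℝ), ∫⁻ x in f ⁻¹' Ioi s \ g ⁻¹' Ioi s, w x ∂ν =
      ∫⁻ x, w x * ENNReal.ofReal (f x - g x) ∂ν := by
  simp_rw [← lintegral_indicator₀ (nullMeasurableSet_preimage_Ioi_sdiff hf hg _)]
  rw [lintegral_lintegral_swap (aemeasurable_indicator_preimage_Ioi_sdiff hf hg hw)]
  refine lintegral_congr_ae ?_
  filter_upwards [hg0] with x hx
  have hind : (fun s : ℝ => (f ⁻¹' Ioi s \ g ⁻¹' Ioi s).indicator w x) =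
      (Ico (g x) (f x)).indicator fun _ => w x := by
    classical
    ext s
    simp only [indicator_apply, Set.mem_sdiff, mem_preimage, mem_Ioi, not_lt, mem_Ico, and_comm]
  have hIoo : Ico (g x) (f x) =ᵐ[volume.restrict (Ioi (0 : ℝ))] Ioo (g x) (f x) :=
    ae_restrict_of_ae Ioo_ae_eq_Ico.symm
  have hsub : Ioo (g x) (f x) ⊆ Ioi 0 := fun s hs => lt_of_le_of_lt hx hs.1
  rw [hind, lintegral_indicator_const measurableSet_Ico, measure_congr hIoo,
    Measure.restrict_apply measurableSet_Ioo, inter_eq_left.2 hsub, Real.volume_Ioo]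

lemma lintegral_lintegral_ofReal_preimage_Ioi_sdiff [SFinite ν] (hf : AEMeasurable f ν)
    (hg : AEMeasurable g ν) (hσ : AEMeasurable σ ν) (hf0 : 0 ≤ᵐ[ν] f) (hg0 : 0 ≤ᵐ[ν] g) :
    ∫⁻ s in Ioi (0 : ℝ), (∫⁻ x in f ⁻¹' Ioi s \ g ⁻¹' Ioi s, ENNReal.ofReal (σ x) ∂ν +
        ∫⁻ x in g ⁻¹' Ioi s \ f ⁻¹' Ioi s, ENNReal.ofReal (-σ x) ∂ν) =
      ∫⁻ x, ENNReal.ofReal (σ x * (f x - g x)) ∂ν := by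
  rw [lintegral_add_left' (aemeasurable_lintegral_preimage_Ioi_sdiff hf hg hσ.ennreal_ofReal),
    lintegral_lintegral_preimage_Ioi_sdiff hf hg hσ.ennreal_ofReal hg0,
    lintegral_lintegral_preimage_Ioi_sdiff (w := fun x => ENNReal.ofReal (-σ x)) hg hf
      hσ.neg.ennreal_ofReal hf0,
    ← lintegral_add_left' (f := fun x => ENNReal.ofReal (σ x) * ENNReal.ofReal (f x - g x))
      (hσ.ennreal_ofReal.mul (hf.sub hg).ennreal_ofReal)]
  refine lintegral_congr fun x => ?_
  rcases le_total 0 (σ x) with h | h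
  · rw [ENNReal.ofReal_of_nonpos (neg_nonpos.2 h), zero_mul, add_zero, ENNReal.ofReal_mul h]
  · rw [ENNReal.ofReal_of_nonpos h, zero_mul, zero_add, ← ENNReal.ofReal_mul (neg_nonneg.2 h),
      neg_mul_comm, neg_sub]

end LayerCake

section CauchySchwarz

lemma two_mul_le_mul_add_inv_mul_inv {b h l : ℝ≥0∞} (hl0 : l ≠ 0) (hl : l ≠ ⊤) (hb : b ≠ ⊤) :
    2 * b ≤ l * (h * b ^ 2) + l⁻¹ * h⁻¹ := by
  rcases eq_or_ne b 0 with rfl | hb0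
  · rw [mul_zero]
    exact zero_le
  rcases eq_or_ne h 0 with rfl | h0
  · rw [ENNReal.inv_zero, ENNReal.mul_top (ENNReal.inv_ne_zero.2 hl), add_top]
    exact le_top
  rcases eq_or_ne h ⊤ with rfl | ht
  · rw [ENNReal.top_mul (pow_ne_zero 2 hb0), ENNReal.mul_top hl0, top_add]
    exact le_top
  have hx0 : l * h ≠ 0 := mul_ne_zero hl0 h0
  have hx : l * h ≠ ⊤ := ENNReal.mul_ne_top hl ht
  rw [← ENNReal.mul_inv (.inl hl0) (.inl hl), ← mul_assoc]
  lift b to ℝ≥0 using hb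
  lift l * h to ℝ≥0 using hx with x
  have hx0 : x ≠ 0 := by exact_mod_cast hx0
  rw [← ENNReal.coe_inv hx0]
  norm_cast
  rw [← NNReal.coe_le_coe]
  push_cast
  have hxpos : 0 < (x : ℝ) := NNReal.coe_pos.2 (pos_iff_ne_zero.2 hx0)
  have hsq : (x : ℝ) * b ^ 2 + (x : ℝ)⁻¹ - 2 * b = (x * b - 1) ^ 2 / x := by
    field_simp
    ring
  linarith [div_nonneg (sq_nonneg ((x : ℝ) * b - 1)) hxpos.le]

lemma sq_le_mul_of_forall_two_mul_le {X J K : ℝ≥0∞} (hJ : J ≠ ⊤) (hK : K ≠ ⊤)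
    (h : ∀ l : ℝ≥0∞, l ≠ 0 → l ≠ ⊤ → 2 * X ≤ l * J + l⁻¹ * K) : X ^ 2 ≤ J * K := by
  have hX : X ≠ ⊤ := by
    have := h 1 one_ne_zero ENNReal.one_ne_top
    rw [inv_one, one_mul, one_mul] at this
    exact (ENNReal.lt_top_of_mul_ne_top_right
      (ne_top_of_le_ne_top (ENNReal.add_ne_top.2 ⟨hJ, hK⟩) this) two_ne_zero).ne
  lift X to ℝ≥0 using hX
  lift J to ℝ≥0 using hJ
  lift K to ℝ≥0 using hK
  have hreal : ∀ l : ℝ, 0 < l → 2 * (X : ℝ) ≤ l * J + l⁻¹ * K := fun l hl => by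
    lift l to ℝ≥0 using hl.le
    have hl0 : l ≠ 0 := (NNReal.coe_pos.1 hl).ne'
    have := h l (ENNReal.coe_ne_zero.2 hl0) ENNReal.coe_ne_top
    rw [← ENNReal.coe_inv hl0] at this
    exact_mod_cast this
  have hdisc := discrim_le_zero (a := (J : ℝ)) (b := -(2 * X)) (c := K) fun l => by
    rcases le_or_gt l 0 with hl | hl
    · have := mul_nonneg X.coe_nonneg (neg_nonneg.2 hl)
      have := mul_nonneg J.coe_nonneg (mul_self_nonneg l)
      linarith [K.coe_nonneg]
    · have := mul_le_mul_of_nonneg_left (hreal l hl) hl.le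
      have hexp : l * (l * J + l⁻¹ * K) = J * (l * l) + K := by field_simp
      linarith
  rw [discrim] at hdisc
  have : (X : ℝ) ^ 2 ≤ J * K := by linarith
  exact_mod_cast this

/-- Hölder's inequality is not available here, since `h` need not be measurable. -/
lemma sq_lintegral_le_mul_lintegral_inv {α : Type*} [MeasurableSpace α] {ν : Measure α}
    {b h D : α → ℝ≥0∞} (hD : AEMeasurable D ν) (hb : ∀ᵐ x ∂ν, b x ≠ ⊤)
    (hle : ∀ᵐ x ∂ν, h x * b x ^ 2 ≤ D x) (hDt : ∫⁻ x, D x ∂ν ≠ ⊤)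
    (hht : ∫⁻ x, (h x)⁻¹ ∂ν ≠ ⊤) :
    (∫⁻ x, b x ∂ν) ^ 2 ≤ (∫⁻ x, D x ∂ν) * ∫⁻ x, (h x)⁻¹ ∂ν := by
  refine sq_le_mul_of_forall_two_mul_le hDt hht fun l hl0 hl => ?_
  calc 2 * ∫⁻ x, b x ∂ν = ∫⁻ x, 2 * b x ∂ν :=
        (lintegral_const_mul' _ _ ENNReal.ofNat_ne_top).symm
    _ ≤ ∫⁻ x, (l * D x + l⁻¹ * (h x)⁻¹) ∂ν := by
        refine lintegral_mono_ae ?_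
        filter_upwards [hb, hle] with x hb hle
        exact (two_mul_le_mul_add_inv_mul_inv hl0 hl hb).trans (by gcongr)
    _ = l * (∫⁻ x, D x ∂ν) + l⁻¹ * ∫⁻ x, (h x)⁻¹ ∂ν := by
        rw [lintegral_add_left' (hD.const_mul _), lintegral_const_mul' _ _ hl,
          lintegral_const_mul' _ _ (ENNReal.inv_ne_top.2 hl0)]

end CauchySchwarz

section IntegratedInequality

lemma integral_abs_sub_add_integral_sub_integral {α : Type*} [MeasurableSpace α] {ν : Measure α}
    {f g : α → ℝ} (hf : Integrable f ν) (hg : Integrable g ν) :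
    ∫ x, |f x - g x| ∂ν + ∫ x, g x ∂ν - ∫ x, f x ∂ν =
      (2 * ∫⁻ x, ENNReal.ofReal (g x - f x) ∂ν).toReal := by
  have hgf : Integrable (fun x => g x - f x) ν := hg.sub hf
  have habs : ∀ x, |f x - g x| = 2 * max (g x - f x) 0 - (g x - f x) := fun x => by
    rcases le_total (g x) (f x) with h | h
    · rw [abs_of_nonneg (sub_nonneg.2 h), max_eq_right (sub_nonpos.2 h)]
      ring
    · rw [abs_of_nonpos (sub_nonpos.2 h), max_eq_left (sub_nonneg.2 h)]
      ring
  have hmax : ∫ x, max (g x - f x) 0 ∂ν = (∫⁻ x, ENNReal.ofReal (g x - f x) ∂ν).toReal := by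
    rw [integral_eq_lintegral_of_nonneg_ae (f := fun x => max (g x - f x) 0)
      (.of_forall fun x => le_max_right _ _) hgf.pos_part.aestronglyMeasurable]
    simp
  simp_rw [habs]
  rw [integral_sub (hgf.pos_part.const_mul 2) hgf, integral_const_mul, hmax, integral_sub hg hf,
    ENNReal.toReal_mul, ENNReal.toReal_ofNat]
  ring

variable {d : ℕ} {Ω : Set (EuclideanSpace ℝ (Fin d))} {σ : EuclideanSpace ℝ (Fin d) → ℝ}
  {f q : EuclideanSpace ℝ (Fin d) → ℝ}

lemma NonnegL1.normL1_eq (hf : NonnegL1 Ω f) : normL1 Ω f = ∫ x in Ω, f x :=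
  integral_congr_ae <| hf.2.mono fun _ hx => abs_of_nonneg hx

namespace Admissible

lemma aemeasurable_beta (hσ : Admissible Ω σ) (hf : NonnegL1 Ω f)
    (q : EuclideanSpace ℝ (Fin d) → ℝ) :
    AEMeasurable (beta Ω f (sigmaRearr Ω σ q)) (volume.restrict (Ioi (0 : ℝ))) := by
  have := aemeasurable_lintegral_preimage_Ioi_sdiff (hσ.aemeasurable_sigmaRearr q)
    hf.1.aemeasurable (aemeasurable_const (b := (1 : ℝ≥0∞)))
  simp only [setLIntegral_one] at this
  rwa [funext (beta_eq hσ.measurable_domain)]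

lemma lintegral_beta (hσ : Admissible Ω σ) (hf : NonnegL1 Ω f)
    (q : EuclideanSpace ℝ (Fin d) → ℝ) :
    ∫⁻ s in Ioi (0 : ℝ), beta Ω f (sigmaRearr Ω σ q) s =
      ∫⁻ x in Ω, ENNReal.ofReal (sigmaRearr Ω σ q x - f x) := by
  have := lintegral_lintegral_preimage_Ioi_sdiff (hσ.aemeasurable_sigmaRearr q)
    hf.1.aemeasurable (aemeasurable_const (b := (1 : ℝ≥0∞))) hf.2
  simp only [setLIntegral_one, one_mul] at this
  rwa [funext (beta_eq hσ.measurable_domain)]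

lemma aemeasurable_secondDiff (hσ : Admissible Ω σ)
    (hI : IntegrableBelow (volume.restrict Ω) σ (eMax Ω σ)) (hf : NonnegL1 Ω f)
    (hq : NonnegL1 Ω q) :
    AEMeasurable (fun s => secondDiff Ω σ (distrib Ω q s) (beta Ω f (sigmaRearr Ω σ q) s))
      (volume.restrict (Ioi (0 : ℝ))) := by
  have hb := (hσ.aemeasurable_beta hf q).ennreal_toReal
  have hm : AEMeasurable (fun s => (distrib Ω q s).toReal) (volume.restrict (Ioi (0 : ℝ))) :=
    antitone_distrib.measurable.ennreal_toReal.aemeasurable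
  have hconj := measurable_shortfallConj (ν := volume.restrict Ω) (σ := σ) (E := eMax Ω σ)
  have hsum := (hconj.comp_aemeasurable (hm.add hb)).add (hconj.comp_aemeasurable (hm.sub hb))
  have hneg := continuous_neg.measurable.comp_aemeasurable
    ((hconj.comp_aemeasurable hm).const_mul 2)
  refine (hsum.add hneg).congr ?_
  filter_upwards [self_mem_ae_restrict measurableSet_Ioi] with s hs
  exact (hσ.secondDiff_eq hI (distrib_ne_top hσ.measurable_domain hq hs)
    (hσ.beta_le_distrib hq f (le_of_lt hs))).symm

lemma lintegral_sigmaRearr (hσ : Admissible Ω σ) (hq : NonnegL1 Ω q) :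
    ∫⁻ x in Ω, ENNReal.ofReal (sigmaRearr Ω σ q x) = ∫⁻ x in Ω, ENNReal.ofReal (q x) := by
  rw [lintegral_eq_lintegral_meas_lt _ (.of_forall (hσ.sigmaRearr_nonneg q))
    (hσ.aemeasurable_sigmaRearr q), lintegral_eq_lintegral_meas_lt _ hq.2 hq.1.aemeasurable]
  refine setLIntegral_congr_fun measurableSet_Ioi fun s hs => ?_
  simp_rw [← distrib_eq hσ.measurable_domain]
  exact hσ.distrib_sigmaRearr hq (le_of_lt hs)

lemma integrableOn_sigmaRearr (hσ : Admissible Ω σ) (hq : NonnegL1 Ω q) :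
    IntegrableOn (sigmaRearr Ω σ q) Ω volume := by
  refine (lintegral_ofReal_ne_top_iff_integrable (hσ.aemeasurable_sigmaRearr q).aestronglyMeasurable
    (.of_forall (hσ.sigmaRearr_nonneg q))).1 ?_
  rw [hσ.lintegral_sigmaRearr hq]
  exact hq.1.lintegral_lt_top.ne

lemma integral_sigmaRearr (hσ : Admissible Ω σ) (hq : NonnegL1 Ω q) :
    ∫ x in Ω, sigmaRearr Ω σ q x = ∫ x in Ω, q x := by
  rw [integral_eq_lintegral_of_nonneg_ae (.of_forall (hσ.sigmaRearr_nonneg q))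
    (hσ.aemeasurable_sigmaRearr q).aestronglyMeasurable,
    integral_eq_lintegral_of_nonneg_ae hq.2 hq.1.aestronglyMeasurable, hσ.lintegral_sigmaRearr hq]

lemma normL1_sub_sigmaRearr_add_sub (hσ : Admissible Ω σ) (hf : NonnegL1 Ω f)
    (hq : NonnegL1 Ω q) :
    normL1 Ω (fun x => f x - sigmaRearr Ω σ q x) + normL1 Ω q - normL1 Ω f =
      (2 * ∫⁻ s in Ioi (0 : ℝ), beta Ω f (sigmaRearr Ω σ q) s).toReal := by
  rw [hq.normL1_eq, hf.normL1_eq, ← hσ.integral_sigmaRearr hq, normL1,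
    integral_abs_sub_add_integral_sub_integral hf.1 (hσ.integrableOn_sigmaRearr hq),
    hσ.lintegral_beta hf]

lemma lintegral_secondDiff_le (hd : 1 ≤ d) (hσ : Admissible Ω σ)
    (hI : IntegrableBelow (volume.restrict Ω) σ (eMax Ω σ)) (hf : NonnegL1 Ω f)
    (hq : NonnegL1 Ω q) (hE : PosPartIntegrable (volume.restrict Ω) (energyDiff Ω σ f q))
    (hC : PosPartIntegrable (volume.restrict (Ioi (0 : ℝ))) (correction Ω σ f q))
    (hfin : ∀ᵐ s ∂volume.restrict (Ioi (0 : ℝ)), bigBExt Ω σ (distrib Ω q s) ≠ ⊤) :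
    ((∫⁻ s in Ioi (0 : ℝ),
        (secondDiff Ω σ (distrib Ω q s) (beta Ω f (sigmaRearr Ω σ q) s)).toENNReal :
          ℝ≥0∞) : EReal) ≤
      extIntegral (volume.restrict Ω) (energyDiff Ω σ f q) +
        extIntegral (volume.restrict (Ioi (0 : ℝ))) (correction Ω σ f q) := by
  have hfm := hf.1.aemeasurable
  have hg := hσ.aemeasurable_sigmaRearr q
  have hσm := hσ.measurable_fun
  have hg0 : 0 ≤ᵐ[volume.restrict Ω] sigmaRearr Ω σ q := .of_forall (hσ.sigmaRearr_nonneg q)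
  refine (coe_le_sub_add_sub_iff hE hC).2 ?_
  have hpos := lintegral_lintegral_ofReal_preimage_Ioi_sdiff hfm hg hσm hf.2 hg0
  have hneg := lintegral_lintegral_ofReal_preimage_Ioi_sdiff hfm hg hσm.neg hf.2 hg0
  have hmeas_pos := (aemeasurable_lintegral_preimage_Ioi_sdiff hfm hg hσm.ennreal_ofReal).add
    (aemeasurable_lintegral_preimage_Ioi_sdiff hg hfm hσm.neg.ennreal_ofReal)
  have hmeas_neg := (aemeasurable_lintegral_preimage_Ioi_sdiff hfm hg hσm.neg.ennreal_ofReal).add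
    (aemeasurable_lintegral_preimage_Ioi_sdiff hg hfm hσm.ennreal_ofReal)
  simp only [Pi.neg_apply, neg_neg, neg_mul] at hneg hmeas_pos hmeas_neg
  simp only [energyDiff, ← EReal.coe_neg, EReal.real_coe_toENNReal]
  rw [← hpos, ← hneg]
  refine (add_le_add_right (le_lintegral_add _ _) _).trans ?_
  refine (lintegral_add_left' hmeas_neg _).ge.trans <|
    (lintegral_mono_ae ?_).trans (lintegral_add_left' hmeas_pos _).le
  filter_upwards [hfin, self_mem_ae_restrict measurableSet_Ioi] with s hs hs0
  exact hσ.level_inequality hd hI hf hq hs0 hs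

end Admissible

end IntegratedInequality

section RefinedInequality

variable {d : ℕ} {Ω : Set (EuclideanSpace ℝ (Fin d))} {σ : EuclideanSpace ℝ (Fin d) → ℝ}
  {f q : EuclideanSpace ℝ (Fin d) → ℝ} {m b : ℝ≥0∞}

lemma distrib_eq_zero_of_eLpNorm_le (hΩ : NullMeasurableSet Ω volume) {t : ℝ} (ht : 0 ≤ t)
    (h : eLpNorm q ⊤ (volume.restrict Ω) ≤ ENNReal.ofReal t) : distrib Ω q t = 0 := by
  rw [eLpNorm_exponent_top] at h
  rw [distrib_eq hΩ, ← compl_compl {x | t < q x}]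
  refine mem_ae_iff.1 ?_
  filter_upwards [enorm_ae_le_eLpNormEssSup q (volume.restrict Ω)] with x hx
  have habs := hx.trans h
  rw [Real.enorm_eq_ofReal_abs, ENNReal.ofReal_le_ofReal_iff ht] at habs
  exact not_lt.2 ((le_abs_self _).trans habs)

lemma bigH_zero : bigH Ω σ 0 = ⊤ := by
  simp [bigH]

lemma bigK_eq (hΩ : NullMeasurableSet Ω volume) :
    bigK Ω σ q = 4 * ∫⁻ t in Ioi (0 : ℝ), ((bigH Ω σ (distrib Ω q t)).toENNReal)⁻¹ := by
  have hS : MeasurableSet {t : ℝ | ENNReal.ofReal t < eLpNorm q ⊤ (volume.restrict Ω)} :=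
    measurableSet_lt ENNReal.measurable_ofReal measurable_const
  have hzero : ∀ t ∈ Ioi (0 : ℝ) \ {t | ENNReal.ofReal t < eLpNorm q ⊤ (volume.restrict Ω)},
      ((bigH Ω σ (distrib Ω q t)).toENNReal)⁻¹ = 0 := fun t ht => by
    rw [distrib_eq_zero_of_eLpNorm_le hΩ (le_of_lt ht.1) (not_lt.1 ht.2), bigH_zero,
      EReal.toENNReal_top, ENNReal.inv_top]
  rw [bigK, ← lintegral_inter_add_sdiff _ (Ioi (0 : ℝ)) hS,
    setLIntegral_eq_zero (measurableSet_Ioi.diff hS) hzero, add_zero]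
  rfl

lemma bigH_nonpos (hm0 : m ≠ 0) (hm : bigBExt Ω σ m = ⊤) : bigH Ω σ m ≤ 0 := by
  refine (iInf₂_le m ⟨pos_iff_ne_zero.2 hm0, le_rfl⟩).trans ?_
  rw [secondDiff, hm, EReal.mul_top_of_pos (by norm_num), EReal.sub_top]
  exact EReal.div_nonpos_of_nonpos_of_nonneg bot_le (pow_nonneg (EReal.coe_ennreal_nonneg _) 2)

lemma toENNReal_bigH_mul_sq_le (hb : b ≤ m) (hm : m ≠ ⊤) :
    (bigH Ω σ m).toENNReal * b ^ 2 ≤ (secondDiff Ω σ m b).toENNReal := by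
  rcases eq_or_ne b 0 with rfl | hb0
  · rw [zero_pow two_ne_zero, mul_zero]
    exact zero_le
  have hpos : (0 : EReal) < ((b ^ 2 : ℝ≥0∞) : EReal) :=
    EReal.coe_ennreal_pos.2 (pos_iff_ne_zero.2 (pow_ne_zero 2 hb0))
  have hle : bigH Ω σ m ≤ secondDiff Ω σ m b / (b : EReal) ^ 2 :=
    iInf₂_le b ⟨pos_iff_ne_zero.2 hb0, hb⟩
  rw [← EReal.coe_ennreal_pow, EReal.le_div_iff_mul_le hpos (EReal.coe_ennreal_eq_top_iff.not.2
    (ENNReal.pow_ne_top (ne_top_of_le_ne_top hm hb)))] at hle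
  have := EReal.toENNReal_le_toENNReal hle
  rwa [EReal.toENNReal_mul' hpos.le, EReal.toENNReal_coe] at this

lemma correction_self (s : ℝ) : correction Ω σ f f s = 0 := by
  have : beta Ω (rearr Ω f) (rearr Ω f) s = 0 :=
    (congrArg volume (eq_empty_of_forall_notMem fun _ hx => hx.2.2.not_ge hx.2.1)).trans
      measure_empty
  rw [correction, this]
  simp

namespace Admissible

lemma ae_bigBExt_ne_top (hσ : Admissible Ω σ)
    (hI : IntegrableBelow (volume.restrict Ω) σ (eMax Ω σ)) (hq : NonnegL1 Ω q)
    (hK : bigK Ω σ q ≠ ⊤) :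
    ∀ᵐ s ∂volume.restrict (Ioi (0 : ℝ)), bigBExt Ω σ (distrib Ω q s) ≠ ⊤ := by
  set A := {s : ℝ | shortfallConj (volume.restrict Ω) σ (eMax Ω σ) (distrib Ω q s).toReal = ⊤}
  have hA : MeasurableSet A := (measurable_shortfallConj.comp
    antitone_distrib.measurable.ennreal_toReal) (measurableSet_singleton ⊤)
  have hAeq : ∀ᵐ s ∂volume.restrict (Ioi (0 : ℝ)),
      (bigBExt Ω σ (distrib Ω q s) = ⊤ ↔ s ∈ A) := by
    filter_upwards [self_mem_ae_restrict measurableSet_Ioi] with s hs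
    rw [hσ.bigBExt_eq hI (distrib_ne_top hσ.measurable_domain hq hs)]
    rfl
  have htop : ∀ᵐ s ∂volume.restrict (Ioi (0 : ℝ)), s ∈ A →
      ⊤ ≤ ((bigH Ω σ (distrib Ω q s)).toENNReal)⁻¹ := by
    filter_upwards [hAeq] with s hs hsA
    have hB := hs.2 hsA
    have hm0 : distrib Ω q s ≠ 0 := fun h0 => EReal.zero_ne_top <| by
      rw [← hB, h0, hσ.bigBExt_eq hI ENNReal.zero_ne_top, ENNReal.toReal_zero,
        hI.shortfallConj_zero]
    rw [EReal.toENNReal_of_nonpos (bigH_nonpos hm0 hB), ENNReal.inv_zero]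
  have hle : ⊤ * volume.restrict (Ioi (0 : ℝ)) A ≤
      ∫⁻ s in Ioi (0 : ℝ), ((bigH Ω σ (distrib Ω q s)).toENNReal)⁻¹ := by
    rw [← setLIntegral_const]
    exact (setLIntegral_mono_ae' hA htop).trans (setLIntegral_le_lintegral _ _)
  have hnull : volume.restrict (Ioi (0 : ℝ)) A = 0 := by
    by_contra h0
    rw [ENNReal.top_mul h0, top_le_iff] at hle
    rw [bigK_eq hσ.measurable_domain, hle, ENNReal.mul_top four_ne_zero] at hK
    exact hK rfl
  filter_upwards [hAeq, measure_eq_zero_iff_ae_notMem.1 hnull] with s hs hsA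
  exact hs.not.2 hsA

lemma sq_two_mul_lintegral_beta_le (hσ : Admissible Ω σ)
    (hI : IntegrableBelow (volume.restrict Ω) σ (eMax Ω σ)) (hf : NonnegL1 Ω f)
    (hq : NonnegL1 Ω q) (hK : bigK Ω σ q ≠ ⊤)
    (hD : ∫⁻ s in Ioi (0 : ℝ),
      (secondDiff Ω σ (distrib Ω q s) (beta Ω f (sigmaRearr Ω σ q) s)).toENNReal ≠ ⊤) :
    (2 * ∫⁻ s in Ioi (0 : ℝ), beta Ω f (sigmaRearr Ω σ q) s) ^ 2 ≤
      bigK Ω σ q * ∫⁻ s in Ioi (0 : ℝ),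
        (secondDiff Ω σ (distrib Ω q s) (beta Ω f (sigmaRearr Ω σ q) s)).toENNReal := by
  rw [bigK_eq hσ.measurable_domain] at hK ⊢
  have hm : ∀ᵐ s ∂volume.restrict (Ioi (0 : ℝ)), distrib Ω q s ≠ ⊤ ∧
      beta Ω f (sigmaRearr Ω σ q) s ≤ distrib Ω q s := by
    filter_upwards [self_mem_ae_restrict measurableSet_Ioi] with s hs
    exact ⟨distrib_ne_top hσ.measurable_domain hq hs, hσ.beta_le_distrib hq f (le_of_lt hs)⟩
  have hsq := sq_lintegral_le_mul_lintegral_inv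
    (hσ.aemeasurable_secondDiff hI hf hq).ereal_toENNReal
    (hm.mono fun _ hs => ne_top_of_le_ne_top hs.1 hs.2)
    (hm.mono fun _ hs => toENNReal_bigH_mul_sq_le hs.2 hs.1) hD
    (fun h => hK (by rw [h, ENNReal.mul_top four_ne_zero]))
  calc _ = 4 * (∫⁻ s in Ioi (0 : ℝ), beta Ω f (sigmaRearr Ω σ q) s) ^ 2 := by ring
    _ ≤ _ := mul_le_mul_right hsq 4
    _ = _ := by ring

theorem sq_normL1_combination_le (hd : 1 ≤ d) (hσ : Admissible Ω σ)
    (hI : IntegrableBelow (volume.restrict Ω) σ (eMax Ω σ)) (hf : NonnegL1 Ω f)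
    (hq : NonnegL1 Ω q) (hK : bigK Ω σ q ≠ ⊤)
    (hE : PosPartIntegrable (volume.restrict Ω) (energyDiff Ω σ f q))
    (hC : PosPartIntegrable (volume.restrict (Ioi (0 : ℝ))) (correction Ω σ f q)) :
    (((normL1 Ω (fun x => f x - sigmaRearr Ω σ q x) + normL1 Ω q - normL1 Ω f) ^ 2 : ℝ) : EReal)
      ≤ (bigK Ω σ q : EReal) *
        (extIntegral (volume.restrict Ω) (energyDiff Ω σ f q)
          + extIntegral (volume.restrict (Ioi (0 : ℝ))) (correction Ω σ f q)) := by
  have hle := hσ.lintegral_secondDiff_le hd hI hf hq hE hC (hσ.ae_bigBExt_ne_top hI hq hK)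
  have hD := EReal.coe_ennreal_eq_top_iff.not.1
    (hle.trans_lt (EReal.add_lt_top (extIntegral_ne_top hE) (extIntegral_ne_top hC))).ne
  have hsq := hσ.sq_two_mul_lintegral_beta_le hI hf hq hK hD
  rw [hσ.normL1_sub_sigmaRearr_add_sub hf hq, ← ENNReal.toReal_pow,
    EReal.coe_ennreal_toReal (ne_top_of_le_ne_top (ENNReal.mul_ne_top hK hD) hsq)]
  refine (EReal.coe_ennreal_le_coe_ennreal_iff.2 hsq).trans ?_
  rw [EReal.coe_ennreal_mul]
  exact mul_le_mul_of_nonneg_left hle (EReal.coe_ennreal_nonneg _)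

theorem extIntegral_secondDiff_le (hd : 1 ≤ d) (hσ : Admissible Ω σ)
    (hI : IntegrableBelow (volume.restrict Ω) σ (eMax Ω σ)) (hf : NonnegL1 Ω f)
    (hq : NonnegL1 Ω q)
    (hE : PosPartIntegrable (volume.restrict Ω) (energyDiff Ω σ f q))
    (hC : PosPartIntegrable (volume.restrict (Ioi (0 : ℝ))) (correction Ω σ f q)) :
    extIntegral (volume.restrict (Ioi (0 : ℝ)))
        (fun s => secondDiff Ω σ (distrib Ω q s) (beta Ω f (sigmaRearr Ω σ q) s))
      + extIntegral (volume.restrict (Ioi (0 : ℝ))) (fun s => -correction Ω σ f q s)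
      ≤ extIntegral (volume.restrict Ω) (energyDiff Ω σ f q) := by
  by_cases hN : ∫⁻ s in Ioi (0 : ℝ),
      (-secondDiff Ω σ (distrib Ω q s) (beta Ω f (sigmaRearr Ω σ q) s)).toENNReal = ⊤
  · rw [extIntegral, hN, EReal.coe_ennreal_top, EReal.sub_top, EReal.bot_add]
    exact bot_le
  have hfin : ∀ᵐ s ∂volume.restrict (Ioi (0 : ℝ)), bigBExt Ω σ (distrib Ω q s) ≠ ⊤ := by
    have hmeas := continuous_neg.measurable.comp_aemeasurable (hσ.aemeasurable_secondDiff hI hf hq)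
    filter_upwards [ae_lt_top' hmeas.ereal_toENNReal hN] with s hs htop
    refine hs.ne ?_
    rw [Function.comp_apply, secondDiff, htop, EReal.mul_top_of_pos (by norm_num), EReal.sub_top,
      EReal.neg_bot, EReal.toENNReal_top]
  rw [extIntegral_neg hC, ← sub_eq_add_neg]
  refine EReal.sub_le_of_le_add ((EReal.sub_le_sub le_rfl (EReal.coe_ennreal_nonneg _)).trans ?_)
  rw [sub_zero]
  exact hσ.lintegral_secondDiff_le hd hI hf hq hE hC hfin

end Admissible

end RefinedInequality

end RefinedHL

theorem theorem1 {d : ℕ} (hd : 1 ≤ d) (Ω : Set (EuclideanSpace ℝ (Fin d)))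
    (σ : EuclideanSpace ℝ (Fin d) → ℝ) (hσ : Admissible Ω σ)
    (hB : ∀ μ : ℝ≥0∞, μ < volume Ω → IntegrableOn σ (sublevel Ω σ μ) volume) :
    -- convexity of `B_σ` on `[0, meas Ω)`
    ConvexOn ℝ {m : ℝ | 0 ≤ m ∧ ENNReal.ofReal m < volume Ω}
        (fun m => bigB Ω σ (ENNReal.ofReal m)) ∧
    -- the refined inequality for two functions; an integral on the right whose positive part
    -- diverges would be `+∞` or undefined
    (∀ q : EuclideanSpace ℝ (Fin d) → ℝ, NonnegL1 Ω q → ¬ (q =ᵐ[volume.restrict Ω] 0) →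
      bigK Ω σ q ≠ ⊤ →
      ∀ f : EuclideanSpace ℝ (Fin d) → ℝ, NonnegL1 Ω f →
        PosPartIntegrable (volume.restrict Ω) (energyDiff Ω σ f q) →
        PosPartIntegrable (volume.restrict (Ioi (0 : ℝ))) (correction Ω σ f q) →
        (((normL1 Ω (fun x => f x - sigmaRearr Ω σ q x) + normL1 Ω q - normL1 Ω f) ^ 2 : ℝ) : EReal)
          ≤ (bigK Ω σ q : EReal) *
            (extIntegral (volume.restrict Ω) (energyDiff Ω σ f q)
              + extIntegral (volume.restrict (Ioi (0 : ℝ))) (correction Ω σ f q))) ∧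
    -- the case `q = f`
    (∀ f : EuclideanSpace ℝ (Fin d) → ℝ, NonnegL1 Ω f → bigK Ω σ f ≠ ⊤ →
        PosPartIntegrable (volume.restrict Ω) (energyDiff Ω σ f f) →
        (((normL1 Ω (fun x => f x - sigmaRearr Ω σ f x)) ^ 2 : ℝ) : EReal)
          ≤ (bigK Ω σ f : EReal) * extIntegral (volume.restrict Ω) (energyDiff Ω σ f f)) ∧
    -- the inequality without finiteness of the constant
    (∀ f q : EuclideanSpace ℝ (Fin d) → ℝ, NonnegL1 Ω f → NonnegL1 Ω q →
        PosPartIntegrable (volume.restrict Ω) (energyDiff Ω σ f q) →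
        PosPartIntegrable (volume.restrict (Ioi (0 : ℝ))) (correction Ω σ f q) →
        extIntegral (volume.restrict (Ioi (0 : ℝ)))
            (fun s => secondDiff Ω σ (distrib Ω q s) (beta Ω f (sigmaRearr Ω σ q) s))
          + extIntegral (volume.restrict (Ioi (0 : ℝ))) (fun s => -correction Ω σ f q s)
          ≤ extIntegral (volume.restrict Ω) (energyDiff Ω σ f q)) := by
  have hI := hσ.integrableBelow hB
  refine ⟨hσ.convexOn_bigB hI,
    fun q hq _ hK f hf hE hC => hσ.sq_normL1_combination_le hd hI hf hq hK hE hC,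
    fun f hf hK hE => ?_,
    fun f q hf hq hE hC => hσ.extIntegral_secondDiff_le hd hI hf hq hE hC⟩
  have hcorr : correction Ω σ f f = fun _ => 0 := funext correction_self
  have hle := hσ.sq_normL1_combination_le hd hI hf hf hK hE (by simp [PosPartIntegrable, hcorr])
  simpa [hcorr, extIntegral] using hle
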